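/- **Setting.** Let $M\ge 2$ and $T_c\ge 1$ be integers. A transmitter with $M$ antennas serves two single-antenna users. In time slot $t=1,2,\dots$ it sends $x_t\in\mathbb C^M$ with $\mathbb E\|x_t\|^2\le P$, and user $i\in\{1,2\}$ receives $y^{(i)}_t=(h^{(i)}_t)^{\mathsf T}x_t+z^{(i)}_t$, where the noise samples $z^{(i)}_t$ are i.i.d. circularly symmetric complex Gaussian of unit power, independent of everything else. The random channel vectors $h^{(i)}_t$ have mean zero and identity covariance, $h^{(1)}_t,h^{(2)}_t$ are almost surely linearly independent, and the channels are constant on each coherence period $\{\ell T_c+1,\dots,(\ell+1)T_c\}$, $\ell\ge 0$ (they may otherwise be correlated over time). For each power $P$ there is a feedback process: $\hat h^{(i)}_{t,t'}$ is the estimate of $h^{(i)}_t$ available to the transmitter at time $t'$. The entries of each error $h^{(i)}_t-\hat h^{(i)}_{t,t'}$ are i.i.d. zero-mean circularly symmetric complex Gaussian, and the current error $h^{(i)}_t-\hat h^{(i)}_{t,t}$ is independent of all estimates available up to time $t$. The current quality exponents $\alpha^{(i)}_t=-\lim_{P\to\infty}\log\mathbb E\|h^{(i)}_t-\hat h^{(i)}_{t,t}\|^2/\log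 P$ are assumed to exist, to be $T_c$-periodic in $t$, and to satisfy $0\le\alpha^{(i)}_1\le\dots\le\alpha^{(i)}_{T_c}\le 1$; put $\bar\alpha^{(i)}=\frac1{T_c}\sum_{t=1}^{T_c}\alpha^{(i)}_t$. The delayed quality exponent of user $i$ is the number $\beta^{(i)}$ (when it exists) such that, for all sufficiently large finite $\eta$ and all $t$, $\beta^{(i)}=-\lim_{P\to\infty}\log\mathbb E\|h^{(i)}_t-\hat h^{(i)}_{t,t+\eta}\|^2/\log P$. **Achievability.** In a code of duration $n$, $x_t$ is a function of the two messages and of the estimates available up to time $t$, and each receiver decodes its message from its $n$ received symbols, knowing all channels and all estimates. A pair $(d_1,d_2)$ is an achievable DoF pair if for every $\varepsilon>0$ and every sufficiently large $n$ there are codes of duration $n$, one for each power $P$, whose rates satisfy $\lim_{P\to\infty}R_i/\log P\ge d_i-\varepsilon$ for $i=1,2$ and whose error probability (for uniform messages) tends to $0$ as $P\to\infty$. **Statement.** Let $d\ge 0$ and suppose $\bar\alpha^{(i)}\ge 3d-2$ for $i=1,2$. 1. If the delayed quality exponents $\beta^{(i)}$ exist, with $\alpha^{(i)}_{T_c}\le\beta^{(i)}\le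 1$, and $\beta^{(i)}\ge 2d-1$ for $i=1,2$, then the symmetric DoF pair $(d,d)$ is achievable. 2. If $\alpha^{(i)}_{T_c}\ge 2d-1$ for $i=1,2$, then $(d,d)$ is achievable with no feedback after the coherence period, that is, with every estimate $\hat h^{(i)}_{t,t'}$ for which $t'$ lies after the end $\ell T_c$ of the coherence period containing $t$ replaced by $\hat h^{(i)}_{t,\ell T_c}$. In the case of symmetric feedback ($\alpha^{(1)}_t=\alpha^{(2)}_t=\alpha_t$, $\beta^{(1)}=\beta^{(2)}=\beta$) the conditions are $\bar\alpha\ge 3d-2$ with $\beta\ge 2d-1$, respectively $\bar\alpha\ge 3d-2$ with $\alpha_{T_c}\ge 2d-1$. -/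

import Mathlib

open MeasureTheory ProbabilityTheory Filter Topology

noncomputable section

namespace MisoBC

/-- Vectors over the `M` transmit antennas, with the Euclidean norm. -/
abbrev Vec (M : ℕ) : Type := EuclideanSpace ℂ (Fin M)

/-- The circularly symmetric complex Gaussian law of mean `0` and variance `v`: the real and the
imaginary part are independent real Gaussians of variance `v / 2`. -/
def complexGaussian (v : NNReal) : Measure ℂ :=
  ((gaussianReal 0 (v / 2)).prod (gaussianReal 0 (v / 2))).map
    (fun p : ℝ × ℝ => (p.1 : ℂ) + (p.2 : ℂ) * Complex.I)

instance (v : NNReal) : IsProbabilityMeasure (complexGaussian v) :=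
  Measure.isProbabilityMeasure_map (by fun_prop)

/-- A fading process of the two users: `h t i ω` is the channel of user `i` in time slot `t`.
Time slots are numbered `0, 1, 2, …`. -/
abbrev Channel (Ω : Type*) (M : ℕ) : Type _ := ℕ → Fin 2 → Ω → Vec M

/-- A feedback process: `est P t t' i ω` is the estimate, available to the transmitter from time
slot `t'` on, of the channel of user `i` in time slot `t`, when the transmit power is `P`. -/
abbrev Feedback (Ω : Type*) (M : ℕ) : Type _ := ℝ → ℕ → ℕ → Fin 2 → Ω → Vec M

/-- The unconjugated product `hᵀ x`. -/
def dotT {M : ℕ} (h x : Vec M) : ℂ := ∑ m, h m * x m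

section Quality

variable {Ω : Type*} [MeasurableSpace Ω] {M : ℕ}

/-- The mean squared error of the estimate of the slot-`t` channel that is available at `t'`. -/
def mse (μ : Measure Ω) (h : Channel Ω M) (est : Feedback Ω M) (P : ℝ) (t t' : ℕ) (i : Fin 2) :
    ℝ :=
  ∫ ω, ‖h t i ω - est P t t' i ω‖ ^ 2 ∂μ

/-- `a = - lim_{P → ∞} log (f P) / log P`, for an eventually positive `f`. -/
def HasQualityExponent (f : ℝ → ℝ) (a : ℝ) : Prop :=
  (∀ᶠ P in atTop, 0 < f P) ∧
    Tendsto (fun P => -(Real.log (f P) / Real.log P)) atTop (𝓝 a)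

/-- `b` is the delayed quality exponent of user `i`, for every time slot: the exponent of the
estimates that arrive `η` slots after the channel, for all sufficiently large finite `η`. -/
def HasDelayedExponent (μ : Measure Ω) (h : Channel Ω M) (est : Feedback Ω M) (i : Fin 2)
    (b : ℝ) : Prop :=
  ∃ η₀ : ℕ, ∀ η, η₀ ≤ η → ∀ t, HasQualityExponent (fun P => mse μ h est P t (t + η) i) b

/-- The feedback process in which no feedback about a channel arrives after the end of its coherence
period: from then on, its estimate stays the one held in the last slot of that period. -/
def stopAfterCoherence (Tc : ℕ) (est : Feedback Ω M) : Feedback Ω M :=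
  fun P t t' i => est P t (min t' (t / Tc * Tc + (Tc - 1))) i

/-- The periodically evolving setting with coherence period `Tc` and current quality exponents
`α i t` (user `i`, slot `t`). The coherence periods are the slots
`ℓ * Tc, …, ℓ * Tc + (Tc - 1)`. -/
structure PeriodicallyEvolving (μ : Measure Ω) (Tc : ℕ) (h : Channel Ω M) (est : Feedback Ω M)
    (α : Fin 2 → ℕ → ℝ) : Prop where
  measurable_channel : ∀ t i, Measurable (h t i)
  measurable_estimate : ∀ P t t' i, Measurable (est P t t' i)
  square_integrable : ∀ t i, MemLp (h t i) 2 μ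
  mean_zero : ∀ t i m, ∫ ω, h t i ω m ∂μ = 0
  covariance_one : ∀ t i m m',
    ∫ ω, h t i ω m * (starRingEnd ℂ) (h t i ω m') ∂μ = if m = m' then 1 else 0
  linearIndependent : ∀ t, ∀ᵐ ω ∂μ, LinearIndependent ℂ (fun i : Fin 2 => h t i ω)
  /-- the channels do not change during a coherence period -/
  block_fading : ∀ t t' i, t / Tc = t' / Tc → h t i =ᵐ[μ] h t' i
  /-- the entries of every estimation error are i.i.d. circularly symmetric complex Gaussian -/
  gaussian_error : ∀ P, 0 < P → ∀ t t' i,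
    (∃ v : NNReal, ∀ m, μ.map (fun ω => (h t i ω - est P t t' i ω) m) = complexGaussian v) ∧
      iIndepFun (fun m ω => (h t i ω - est P t t' i ω) m) μ
  /-- the current estimation error is independent of all estimates available so far -/
  error_independent : ∀ P, 0 < P → ∀ t i,
    IndepFun (fun ω => h t i ω - est P t t i ω)
      (fun ω (s : ℕ) (t' : Set.Iic t) (j : Fin 2) => est P s t' j ω) μ
  current_exponent : ∀ t i, HasQualityExponent (fun P => mse μ h est P t t i) (α i t)
  periodic : ∀ i t, α i (t + Tc) = α i t
  exponent_nonneg : ∀ i t, 0 ≤ α i t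
  exponent_le_one : ∀ i t, α i t ≤ 1
  /-- the feedback accumulates during the coherence period -/
  exponent_mono : ∀ i s t, s ≤ t → t < Tc → α i s ≤ α i t

end Quality

/-- A code for two users over `n` channel uses. Message `i`, for user `i`, has `size i` values.
The transmitter sees, in slot `t`, the estimates (of any channel) available up to slot `t`. Receiver
`i` sees its `n` received symbols, all the channels of both users and all the estimates. -/
structure Code (M n : ℕ) where
  size : Fin 2 → ℕ
  size_pos : ∀ i, 0 < size i
  enc : Fin n → ((i : Fin 2) → Fin (size i)) → (Fin n → Fin n → Fin 2 → Vec M) → Vec M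
  enc_measurable : ∀ t w, Measurable (enc t w)
  enc_causal : ∀ t w e e', (∀ s t' i, t' ≤ t → e s t' i = e' s t' i) → enc t w e = enc t w e'
  dec : (i : Fin 2) →
    (Fin n → ℂ) × (Fin n → Fin 2 → Vec M) × (Fin n → Fin n → Fin 2 → Vec M) → Fin (size i)
  dec_measurable : ∀ i, Measurable (dec i)

namespace Code

variable {Ω : Type*} [MeasurableSpace Ω] {M n : ℕ}

/-- The channels of the first `n` slots. -/
def channels (h : Channel Ω M) (ω : Ω) : Fin n → Fin 2 → Vec M := fun t i => h t i ω

/-- The estimates, exchanged during the first `n` slots, of the channels of these slots. -/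
def estimates (est : Feedback Ω M) (P : ℝ) (ω : Ω) : Fin n → Fin n → Fin 2 → Vec M :=
  fun t t' i => est P t t' i ω

/-- The transmitted vector of slot `t` for the messages `w`. -/
def input (C : Code M n) (est : Feedback Ω M) (P : ℝ) (w : (i : Fin 2) → Fin (C.size i))
    (t : Fin n) (ω : Ω) : Vec M :=
  C.enc t w (estimates est P ω)

/-- The received symbols `hᵀ x + z` of user `i`, where `z` are the noise samples. -/
def output (C : Code M n) (h : Channel Ω M) (est : Feedback Ω M) (P : ℝ)
    (w : (i : Fin 2) → Fin (C.size i)) (i : Fin 2) (ω : Ω) (z : Fin 2 × Fin n → ℂ) : Fin n → ℂ :=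
  fun t => dotT (h t i ω) (C.input est P w t ω) + z (i, t)

/-- The power constraint `E ‖x_t‖² ≤ P` in every slot, for uniformly distributed messages. -/
def PowerConstraint (C : Code M n) (μ : Measure Ω) (est : Feedback Ω M) (P : ℝ) : Prop :=
  ∀ t : Fin n, (∑ w : ((i : Fin 2) → Fin (C.size i)), ∫⁻ ω, ‖C.input est P w t ω‖ₑ ^ 2 ∂μ) /
    ((C.size 0 * C.size 1 : ℕ) : ENNReal) ≤ ENNReal.ofReal P

/-- The probability that some user decodes its message wrongly, for uniformly distributed messages.
The noise samples are i.i.d. complex Gaussian of unit power, and independent of the channels,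
the estimates and the messages. -/
def errorProb (C : Code M n) (μ : Measure Ω) (h : Channel Ω M) (est : Feedback Ω M) (P : ℝ) :
    ENNReal :=
  (∑ w : ((i : Fin 2) → Fin (C.size i)),
    (μ.prod (Measure.pi (fun _ : Fin 2 × Fin n => complexGaussian 1)))
      {p | ∃ i, C.dec i (C.output h est P w i p.1 p.2, channels h p.1, estimates est P p.1) ≠ w i}) /
    ((C.size 0 * C.size 1 : ℕ) : ENNReal)

/-- The rate of user `i`, in bits per channel use. -/
def rate (C : Code M n) (i : Fin 2) : ℝ := Real.logb 2 (C.size i) / n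

end Code

/-- The pair `(d 0, d 1)` of degrees of freedom is achievable. The regime is that of a large duration
`n` and of a power `P` much larger than `n`: up to any `ε > 0`, for all sufficiently long
durations `n` there are codes `C P` of duration `n`, one for each power, that satisfy the power
constraint, have `lim R_i / log P` at least `d i - ε`, and have an error probability that vanishes
as `P → ∞`. -/
def AchievableDoF {Ω : Type*} [MeasurableSpace Ω] {M : ℕ} (μ : Measure Ω) (h : Channel Ω M)
    (est : Feedback Ω M) (d : Fin 2 → ℝ) : Prop :=
  ∀ ε : ℝ, 0 < ε → ∃ n₀ : ℕ, ∀ n, n₀ ≤ n → ∃ C : ℝ → Code M n,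
    (∀ P, 0 < P → (C P).PowerConstraint μ est P) ∧
    (∀ i, ∃ r : ℝ, d i - ε ≤ r ∧
      Tendsto (fun P => (C P).rate i / Real.logb 2 P) atTop (𝓝 r)) ∧
    Tendsto (fun P => (C P).errorProb μ h est P) atTop (𝓝 0)

end MisoBC

end

noncomputable section

namespace MisoBC

/-! ### Selecting the unique member of a finite measurable family -/

/-! The amplitude scale is cut into `N` levels of ratio `R = P ^ (1 / (2N))`, and symbols are
integers in base `q = ⌊R / 4⌋`. For fixed `N`, bounded powers of `R` absorb all constants, channel
norms, ill-conditioning and noise, so that outside an event of vanishing probability decoding is a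
deterministic separation argument.

In each slot every user gets two private symbols. One has power exponent `δ` and is zero-forced with
the current estimate of the other user's channel; the other has exponent `δ - α'` and is sent in a
fixed generic direction, where `α' ≤ α` is a possibly degraded current quality. Both reach the other
user at exponent `δ - α'`. This disturbance is reconstructed at the transmitter from the delayed
estimate, accurately enough because `δ ≤ β`, then quantised and sent a few blocks later in a common
signal, together with fresh digits. The quantised disturbance serves twice: the disturbed user
removes it, and the intended user takes it as a second equation for its two symbols
(`symbols_small`).

Blocks are decoded backwards (`message_eq_of_close`). Once the disturbance in a block is known, its
common signal is read off above the user's own private signal (`pay_eq_of_close`), which reveals the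
disturbance of an earlier block.

The count (`exists_digit_allocation`): let `δ` have mean `2d - 1`, possible as `β ≥ 2d - 1`. The
common signal then has exponent `1 - (2d - 1) = 2 - 2d` on average. The disturbances cost `2d - 1`
minus the mean of `α'` for each user, which leaves each user `2 - 3d` plus that mean for fresh
digits, nonnegative as the mean is at least `3d - 2`. Private and fresh digits add up to `d`.
Without feedback after the coherence period, the current estimate in its last slot plays the part of
the delayed one. -/

theorem exists_measurable_select {X : Type*} [MeasurableSpace X] {k : ℕ} (hk : 0 < k)
    (S : Fin k → Set X) (hS : ∀ w, MeasurableSet (S w)) :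
    ∃ f : X → Fin k, Measurable f ∧ ∀ x w, x ∈ S w → (∀ w', x ∈ S w' → w' = w) → f x = w := by
  classical
  let T : Fin k → Set X := fun w => S w \ ⋃ w' ∈ {w' | w' ≠ w}, S w'
  have hT : ∀ w, MeasurableSet (T w) := fun w =>
    (hS w).diff (MeasurableSet.biUnion (Set.to_countable _) fun w' _ => hS w')
  have huniq : ∀ x w w', x ∈ T w → x ∈ T w' → w = w' := by
    intro x w w' h1 h2
    by_contra hne
    exact h1.2 (Set.mem_biUnion (x := w') (Ne.symm hne) h2.1)
  -- Points lying in none or in several of the sets get the default value `0`; this is the extra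
  -- piece in the fibre over `0` below.
  let f : X → Fin k := fun x => if hx : ∃ w, x ∈ T w then hx.choose else ⟨0, hk⟩
  have hf : ∀ x w, x ∈ T w → f x = w := by
    intro x w hx
    have hex : ∃ w, x ∈ T w := ⟨w, hx⟩
    simp only [f, dif_pos hex]
    exact huniq x _ _ hex.choose_spec hx
  refine ⟨f, ?_, ?_⟩
  · refine measurable_to_countable' fun w => ?_
    have : f ⁻¹' {w} = T w ∪ (if w = ⟨0, hk⟩ then (⋃ w', T w')ᶜ else ∅) := by
      ext x
      by_cases hx : ∃ w', x ∈ T w'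
      · obtain ⟨w', hw'⟩ := hx
        have h1 := hf x w' hw'
        have h2 : x ∉ (if w = ⟨0, hk⟩ then (⋃ w', T w')ᶜ else ∅ : Set X) := by
          split_ifs
          · simp only [Set.mem_compl_iff, not_not]
            exact Set.mem_iUnion.2 ⟨w', hw'⟩
          · simp
        simp only [Set.mem_preimage, Set.mem_singleton_iff, h1, Set.mem_union, h2, or_false]
        exact ⟨fun h => h ▸ hw', fun h => huniq x _ _ hw' h⟩
      · have h1 : f x = ⟨0, hk⟩ := by simp only [f, dif_neg hx]
        have h2 : x ∉ T w := fun h => hx ⟨w, h⟩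
        simp only [Set.mem_preimage, Set.mem_singleton_iff, h1, Set.mem_union, h2, false_or]
        split_ifs with hw
        · simp only [hw, true_iff, Set.mem_compl_iff, Set.mem_iUnion]
          exact hx
        · simp only [Set.mem_empty_iff_false, iff_false]
          exact fun h => hw h.symm
    rw [this]
    refine (hT w).union ?_
    split_ifs
    · exact (MeasurableSet.iUnion hT).compl
    · exact MeasurableSet.empty
  · intro x w hx hu
    refine hf x w ⟨hx, ?_⟩
    simp only [Set.mem_iUnion, not_exists]
    intro w' hw' hx'
    exact hw' (hu w' hx')

/-! ### The unconjugated product -/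

/-- The entrywise conjugate of a vector. -/
def conjV {M : ℕ} (g : Vec M) : Vec M := WithLp.toLp 2 (fun m => (starRingEnd ℂ) (g m))

@[simp] theorem conjV_apply {M : ℕ} (g : Vec M) (m : Fin M) :
    conjV g m = (starRingEnd ℂ) (g m) := rfl

@[simp] theorem norm_conjV {M : ℕ} (g : Vec M) : ‖conjV g‖ = ‖g‖ := by
  simp [EuclideanSpace.norm_eq]

theorem conjV_sub {M : ℕ} (g k : Vec M) : conjV (g - k) = conjV g - conjV k := by
  ext m; simp

theorem dotT_eq_inner {M : ℕ} (g x : Vec M) : dotT g x = inner ℂ (conjV g) x := by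
  simp [dotT, PiLp.inner_apply, mul_comm]

theorem norm_dotT_le {M : ℕ} (g x : Vec M) : ‖dotT g x‖ ≤ ‖g‖ * ‖x‖ := by
  rw [dotT_eq_inner]
  simpa using norm_inner_le_norm (𝕜 := ℂ) (conjV g) x

theorem dotT_comm {M : ℕ} (g x : Vec M) : dotT g x = dotT x g := by
  simp [dotT, mul_comm]

theorem dotT_add {M : ℕ} (g x y : Vec M) : dotT g (x + y) = dotT g x + dotT g y := by
  simp [dotT_eq_inner]

theorem dotT_sub {M : ℕ} (g x y : Vec M) : dotT g (x - y) = dotT g x - dotT g y := by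
  simp [dotT_eq_inner]

theorem dotT_smul {M : ℕ} (g : Vec M) (c : ℂ) (x : Vec M) : dotT g (c • x) = c * dotT g x := by
  simp [dotT_eq_inner]

theorem dotT_zero {M : ℕ} (g : Vec M) : dotT g 0 = 0 := by
  simp [dotT_eq_inner]

theorem sub_dotT {M : ℕ} (g k x : Vec M) : dotT (g - k) x = dotT g x - dotT k x := by
  rw [dotT_comm, dotT_sub, dotT_comm x, dotT_comm x]

theorem smul_dotT {M : ℕ} (c : ℂ) (g x : Vec M) : dotT (c • g) x = c * dotT g x := by
  rw [dotT_comm, dotT_smul, dotT_comm x]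

@[fun_prop]
theorem continuous_dotT {M : ℕ} : Continuous (fun p : Vec M × Vec M => dotT p.1 p.2) := by
  unfold dotT; fun_prop

theorem measurable_dotT {M : ℕ} {X : Type*} [MeasurableSpace X] {f g : X → Vec M}
    (hf : Measurable f) (hg : Measurable g) : Measurable (fun x => dotT (f x) (g x)) :=
  continuous_dotT.measurable.comp (hf.prodMk hg)

theorem continuous_conjV {M : ℕ} : Continuous (conjV : Vec M → Vec M) := by
  unfold conjV
  refine (PiLp.continuous_toLp 2 _).comp ?_
  fun_prop

theorem measurable_conjV {M : ℕ} : Measurable (conjV : Vec M → Vec M) :=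
  continuous_conjV.measurable

/-! ### Codes from separated signals -/

/-- If, outside a rare event, the received signals of a finite family of causal encoders separate the
messages of each user by more than twice the noise, then the encoders come with good decoders. -/
theorem exists_code_of_separated {Ω : Type*} [MeasurableSpace Ω] (μ : Measure Ω)
    [IsProbabilityMeasure μ] {M n : ℕ} (W : Fin 2 → Type) [∀ i, Fintype (W i)]
    [∀ i, Nonempty (W i)]
    (X : Fin n → (∀ i, W i) → (Fin n → Fin n → Fin 2 → Vec M) → Vec M)
    (hmeas : ∀ t w, Measurable (X t w))
    (hcausal : ∀ t w e e', (∀ s t' i, t' ≤ t → e s t' i = e' s t' i) → X t w e = X t w e')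
    (h : Channel Ω M) (est : Feedback Ω M) (P R : ℝ)
    (hpow : ∀ e t w, ‖X t w e‖ ^ 2 ≤ P) (G : Set Ω)
    (hsep : ∀ ω ∈ G, ∀ i (w w' : ∀ i, W i),
      (∀ t : Fin n, ‖dotT (h t i ω) (X t w (Code.estimates est P ω)) -
        dotT (h t i ω) (X t w' (Code.estimates est P ω))‖ ≤ 2 * R) → w i = w' i) :
    ∃ C : Code M n, (∀ i, C.size i = Fintype.card (W i)) ∧ C.PowerConstraint μ est P ∧
      C.errorProb μ h est P ≤ μ Gᶜ +
        (Measure.pi (fun _ : Fin 2 × Fin n => complexGaussian 1)) {z | ∃ p, R < ‖z p‖} := by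
  classical
  let E : ∀ i, Fin (Fintype.card (W i)) ≃ W i := fun i => (Fintype.equivFin (W i)).symm
  let D : (∀ i, Fin (Fintype.card (W i))) → ∀ i, W i := fun w i => E i (w i)
  -- The decoder of user `i` lists the values of its own message that, with some message of the
  -- other user, explain the whole received sequence up to noise `R`.
  let S : ∀ i : Fin 2, Fin (Fintype.card (W i)) →
      Set ((Fin n → ℂ) × (Fin n → Fin 2 → Vec M) × (Fin n → Fin n → Fin 2 → Vec M)) :=
    fun i v => ⋃ w : {w : ∀ i, Fin (Fintype.card (W i)) // w i = v},
      ⋂ t : Fin n, {p | ‖p.1 t - dotT (p.2.1 t i) (X t (D w) p.2.2)‖ ≤ R}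
  have hS : ∀ i v, MeasurableSet (S i v) := by
    intro i v
    refine MeasurableSet.iUnion fun w => MeasurableSet.iInter fun t => ?_
    refine measurableSet_le (Measurable.norm ?_) measurable_const
    have h1 : Measurable fun p : (Fin n → ℂ) × (Fin n → Fin 2 → Vec M) ×
        (Fin n → Fin n → Fin 2 → Vec M) => p.2.1 t i :=
      (measurable_pi_apply i).comp ((measurable_pi_apply t).comp
        (measurable_fst.comp measurable_snd))
    have h2 : Measurable fun p : (Fin n → ℂ) × (Fin n → Fin 2 → Vec M) ×
        (Fin n → Fin n → Fin 2 → Vec M) => X t (D w) p.2.2 :=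
      (hmeas t _).comp (measurable_snd.comp measurable_snd)
    exact ((measurable_pi_apply t).comp measurable_fst).sub (measurable_dotT h1 h2)
  choose dec hdm hdec using fun i =>
    exists_measurable_select (Fintype.card_pos : 0 < Fintype.card (W i)) (S i) (hS i)
  let C : Code M n :=
    { size := fun i => Fintype.card (W i)
      size_pos := fun i => Fintype.card_pos
      enc := fun t w e => X t (D w) e
      enc_measurable := fun t w => hmeas t _
      enc_causal := fun t w e e' he => hcausal t _ e e' he
      dec := dec
      dec_measurable := hdm }
  have hcard : ((Fintype.card (W 0) * Fintype.card (W 1) : ℕ) : ENNReal) =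
      ((Finset.univ : Finset (∀ i, Fin (C.size i))).card : ENNReal) := by
    rw [Finset.card_univ, Fintype.card_pi, Fin.prod_univ_two]
    simp [C]
  have hne : ((Fintype.card (W 0) * Fintype.card (W 1) : ℕ) : ENNReal) ≠ 0 := by
    exact_mod_cast (Nat.mul_pos Fintype.card_pos Fintype.card_pos).ne'
  have havg : ∀ (f : (∀ i, Fin (C.size i)) → ENNReal) (b : ENNReal), (∀ w, f w ≤ b) →
      (∑ w, f w) / ((C.size 0 * C.size 1 : ℕ) : ENNReal) ≤ b := by
    intro f b hf
    refine ENNReal.div_le_of_le_mul ?_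
    refine (Finset.sum_le_card_nsmul _ _ b fun w _ => hf w).trans ?_
    rw [nsmul_eq_mul, ← hcard, mul_comm]
  refine ⟨C, fun i => rfl, ?_, ?_⟩
  · intro t
    refine havg _ _ fun w => ?_
    refine (lintegral_mono (g := fun _ => ENNReal.ofReal P) fun ω => ?_).trans (by simp)
    have := hpow (Code.estimates est P ω) t (D w)
    change ‖X t (D w) (Code.estimates est P ω)‖ₑ ^ 2 ≤ _
    rw [← ofReal_norm, ← ENNReal.ofReal_pow (norm_nonneg _)]
    exact ENNReal.ofReal_le_ofReal this
  · refine havg _ _ fun w => ?_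
    set ν := Measure.pi (fun _ : Fin 2 × Fin n => complexGaussian 1)
    have hsub : {p : Ω × (Fin 2 × Fin n → ℂ) | ∃ i, C.dec i
        (C.output h est P w i p.1 p.2, Code.channels h p.1, Code.estimates est P p.1) ≠ w i} ⊆
        Gᶜ ×ˢ Set.univ ∪ Set.univ ×ˢ {z | ∃ p, R < ‖z p‖} := by
      rintro ⟨ω, z⟩ ⟨i, hi⟩
      by_contra hcon
      simp only [Set.mem_union, Set.mem_prod, Set.mem_compl_iff, Set.mem_univ, and_true,
        Set.mem_ofPred_eq, true_and, not_or, not_not, not_exists, not_lt] at hcon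
      obtain ⟨hG, hz⟩ := hcon
      -- Noise of size at most `R` puts the true message on the list, and any two explanations of
      -- one received sequence are within `2 * R` of each other.
      refine hi (hdec i _ _ ?_ ?_)
      · refine Set.mem_iUnion.2 ⟨⟨w, rfl⟩, Set.mem_iInter.2 fun t => ?_⟩
        have : C.output h est P w i ω z t -
            dotT (h t i ω) (X t (D w) (Code.estimates est P ω)) = z (i, t) := by
          simp only [Code.output, Code.input, C]; ring
        simp only [Set.mem_ofPred_eq, Code.channels]
        rw [this]
        exact hz (i, t)
      · intro v hv
        obtain ⟨⟨w', hw'⟩, hv⟩ := Set.mem_iUnion.1 hv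
        have hv := Set.mem_iInter.1 hv
        have key := hsep ω hG i (D w) (D w') fun t => by
          have h1 := hv t
          simp only [Set.mem_ofPred_eq, Code.channels] at h1
          have h2 : dotT (h t i ω) (X t (D w) (Code.estimates est P ω)) -
              dotT (h t i ω) (X t (D w') (Code.estimates est P ω)) =
              (C.output h est P w i ω z t -
                dotT (h t i ω) (X t (D w') (Code.estimates est P ω))) - z (i, t) := by
            simp only [Code.output, Code.input, C]; ring
          rw [h2]
          refine (norm_sub_le _ _).trans ?_
          have := hz (i, t)
          linarith
        have := (E i).injective key
        rw [← hw', this]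
    refine (measure_mono hsub).trans ((measure_union_le _ _).trans ?_)
    rw [Measure.prod_prod, Measure.prod_prod]
    simp

/-! ### Events of vanishing probability -/

theorem tendsto_measure_lt_atTop {X : Type*} [MeasurableSpace X] (ν : Measure X)
    [IsFiniteMeasure ν] {f : X → ℝ} (hf : Measurable f) :
    Tendsto (fun R : ℝ => ν {x | R < f x}) atTop (𝓝 0) := by
  have hempty : (⋂ R : ℝ, {x | R < f x}) = ∅ := by
    ext x
    simp only [Set.mem_iInter, Set.mem_ofPred_eq, Set.mem_empty_iff_false, iff_false, not_forall,
      not_lt]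
    exact ⟨f x, le_rfl⟩
  have := tendsto_measure_iInter_atTop (μ := ν) (s := fun R : ℝ => {x | R < f x})
    (fun R => (measurableSet_lt measurable_const hf).nullMeasurableSet)
    (fun R R' hR x hx => lt_of_le_of_lt hR hx) ⟨0, measure_ne_top _ _⟩
  rwa [hempty, measure_empty] at this

/-- Almost sure nonvanishing is enough: `‖f‖⁻¹` is a fixed finite random variable, so its tail
vanishes without any rate. -/
theorem tendsto_measure_norm_lt_inv {X : Type*} [MeasurableSpace X] (ν : Measure X)
    [IsFiniteMeasure ν] {f : X → ℂ} (hf : Measurable f) (h0 : ∀ᵐ x ∂ν, f x ≠ 0) (c : ℝ) :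
    Tendsto (fun R : ℝ => ν {x | R * ‖f x‖ < c}) atTop (𝓝 0) := by
  have h1 := tendsto_measure_lt_atTop ν (f := fun x => c * ‖f x‖⁻¹)
    ((hf.norm.inv).const_mul c)
  refine tendsto_of_tendsto_of_tendsto_of_le_of_le tendsto_const_nhds h1 (fun _ => zero_le) ?_
  intro R
  refine measure_mono_ae ?_
  filter_upwards [h0] with x hx hlt
  have hpos : 0 < ‖f x‖ := norm_pos_iff.2 hx
  change R * ‖f x‖ < c at hlt
  change R < c * ‖f x‖⁻¹
  rwa [← div_eq_mul_inv, lt_div_iff₀ hpos]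

/-- The amplitude unit `P ^ (1 / (2 N))`. -/
def unit (N : ℕ) (P : ℝ) : ℝ := P ^ (1 / (2 * (N : ℝ)))

theorem unit_pos (N : ℕ) {P : ℝ} (hP : 0 < P) : 0 < unit N P := Real.rpow_pos_of_pos hP _

theorem unit_pow {N : ℕ} {P : ℝ} (hP : 0 < P) (k : ℕ) :
    unit N P ^ k = P ^ ((k : ℝ) / (2 * N)) := by
  rw [unit, ← Real.rpow_natCast, ← Real.rpow_mul hP.le]
  congr 1; ring

theorem unit_pow_two_mul {N : ℕ} (hN : 0 < N) {P : ℝ} (hP : 0 < P) :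
    (unit N P ^ N) ^ 2 = P := by
  rw [← pow_mul, unit_pow hP]
  have : ((N * 2 : ℕ) : ℝ) / (2 * N) = 1 := by
    have : (N : ℝ) ≠ 0 := by positivity
    push_cast; field_simp
  rw [this, Real.rpow_one]

theorem tendsto_unit {N : ℕ} (hN : 0 < N) : Tendsto (unit N) atTop atTop :=
  tendsto_rpow_atTop (by positivity)

/-- Markov's inequality for the squared error. The factor `unit N P` granted on the left is worth `P
^ (1 / N)` after squaring; half of it absorbs the subpolynomial deviation of the mean squared error
from `P ^ (-a)`, and the other half makes the bound vanish. -/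
theorem tendsto_measure_error {Ω : Type*} [MeasurableSpace Ω] {μ : Measure Ω}
    [IsFiniteMeasure μ] {M N : ℕ} (hN : 0 < N) {f : ℝ → Ω → Vec M} {a : ℝ}
    (ha : HasQualityExponent (fun P => ∫ ω, ‖f P ω‖ ^ 2 ∂μ) a) {m : ℕ} (hm : (m : ℝ) ≤ N * a) :
    Tendsto (fun P => μ {ω | unit N P < ‖f P ω‖ * unit N P ^ m}) atTop (𝓝 0) := by
  have hN' : (0 : ℝ) < N := by exact_mod_cast hN
  have hlim : Tendsto (fun P : ℝ => ENNReal.ofReal (P ^ (-(1 / (2 * (N : ℝ)))))) atTop (𝓝 0) := by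
    rw [← ENNReal.ofReal_zero]
    exact ENNReal.tendsto_ofReal (tendsto_rpow_neg_atTop (by positivity))
  refine tendsto_of_tendsto_of_tendsto_of_le_of_le' tendsto_const_nhds hlim
    (Eventually.of_forall fun _ => zero_le) ?_
  have hgt : a - 1 / (2 * (N : ℝ)) < a := by
    have : 0 < 1 / (2 * (N : ℝ)) := by positivity
    linarith
  filter_upwards [ha.1, ha.2.eventually (lt_mem_nhds hgt), eventually_gt_atTop 1] with P hpos hlt hP
  have hP0 : 0 < P := by linarith
  have hlogP : 0 < Real.log P := Real.log_pos hP
  have hmse : ∫ ω, ‖f P ω‖ ^ 2 ∂μ ≤ P ^ (-a + 1 / (2 * (N : ℝ))) := by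
    rw [← Real.log_le_log_iff hpos (Real.rpow_pos_of_pos hP0 _), Real.log_rpow hP0]
    have h1 : Real.log (∫ ω, ‖f P ω‖ ^ 2 ∂μ) / Real.log P < -a + 1 / (2 * (N : ℝ)) := by linarith
    rw [div_lt_iff₀ hlogP] at h1
    exact h1.le
  have hint : Integrable (fun ω => ‖f P ω‖ ^ 2) μ := by
    by_contra hni
    rw [integral_undef hni] at hpos
    exact lt_irrefl _ hpos
  have hU := unit_pos N hP0
  set r : ℝ := unit N P ^ 2 / (unit N P ^ m) ^ 2 with hr
  have hrpos : 0 < r := by positivity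
  have hmark := mul_meas_ge_le_integral_of_nonneg (μ := μ) (f := fun ω => ‖f P ω‖ ^ 2)
    (Eventually.of_forall fun ω => by positivity) hint r
  have hsub : {ω | unit N P < ‖f P ω‖ * unit N P ^ m} ⊆ {ω | r ≤ ‖f P ω‖ ^ 2} := by
    intro ω hω
    change unit N P < ‖f P ω‖ * unit N P ^ m at hω
    change r ≤ ‖f P ω‖ ^ 2
    rw [hr, div_le_iff₀ (by positivity), ← mul_pow]
    exact pow_le_pow_left₀ hU.le hω.le 2
  have hreal : μ.real {ω | r ≤ ‖f P ω‖ ^ 2} ≤ P ^ (-(1 / (2 * (N : ℝ)))) := by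
    have h2 : μ.real {ω | r ≤ ‖f P ω‖ ^ 2} ≤ (∫ ω, ‖f P ω‖ ^ 2 ∂μ) / r := by
      rw [le_div_iff₀ hrpos, mul_comm]; exact hmark
    refine h2.trans ?_
    have hrP : r = P ^ (1 / (N : ℝ) - m / N) := by
      rw [hr, ← pow_mul, unit_pow hP0, unit_pow hP0, ← Real.rpow_sub hP0]
      congr 1
      push_cast; field_simp
    rw [hrP, div_le_iff₀ (Real.rpow_pos_of_pos hP0 _), ← Real.rpow_add hP0]
    refine hmse.trans (Real.rpow_le_rpow_of_exponent_le hP.le ?_)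
    have : (m : ℝ) / N ≤ a := by rw [div_le_iff₀ hN']; linarith
    have h3 : 1 / (N : ℝ) = 1 / (2 * (N : ℝ)) + 1 / (2 * (N : ℝ)) := by field_simp; norm_num
    linarith
  calc μ {ω | unit N P < ‖f P ω‖ * unit N P ^ m} ≤ μ {ω | r ≤ ‖f P ω‖ ^ 2} := measure_mono hsub
    _ = ENNReal.ofReal (μ.real {ω | r ≤ ‖f P ω‖ ^ 2}) := by
      rw [Measure.real, ENNReal.ofReal_toReal (measure_ne_top _ _)]
    _ ≤ _ := ENNReal.ofReal_le_ofReal hreal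

/-! ### Generic directions -/

/-- A point `x` of the moment curve turns `dotT (f k ω) ·` into a nonzero polynomial in `x`, with
finitely many roots. By Fubini almost every `x` is good for almost every `ω`, and countably many
conditions can be met at once. The direction is deterministic, hence does not depend on `P`. -/
theorem exists_generic_vec {Ω : Type*} [MeasurableSpace Ω] (μ : Measure Ω) [SFinite μ] {M : ℕ}
    {ι : Type*} [Countable ι] (f : ι → Ω → Vec M) (hf : ∀ k, Measurable (f k))
    (h0 : ∀ k, ∀ᵐ ω ∂μ, f k ω ≠ 0) : ∃ u : Vec M, ∀ k, ∀ᵐ ω ∂μ, dotT (f k ω) u ≠ 0 := by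
  let curve : ℝ → Vec M := fun x => WithLp.toLp 2 (fun m => ((x : ℂ)) ^ (m : ℕ))
  have hcurve : Measurable curve := by
    refine ((PiLp.continuous_toLp 2 _).comp ?_).measurable
    fun_prop
  have key : ∀ k, ∀ᵐ x : ℝ, ∀ᵐ ω ∂μ, dotT (f k ω) (curve x) ≠ 0 := by
    intro k
    have hm : Measurable fun p : Ω × ℝ => dotT (f k p.1) (curve p.2) :=
      measurable_dotT ((hf k).comp measurable_fst) (hcurve.comp measurable_snd)
    have hnull : (μ.prod volume) {p : Ω × ℝ | dotT (f k p.1) (curve p.2) = 0} = 0 := by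
      refine (Measure.measure_prod_null (hm (measurableSet_singleton 0))).2 ?_
      filter_upwards [h0 k] with ω hω
      let p : Polynomial ℂ := ∑ m : Fin M, Polynomial.monomial (m : ℕ) (f k ω m)
      have hp : p ≠ 0 := by
        intro hp
        apply hω
        ext m
        have h1 : p.coeff (m : ℕ) = f k ω m := by
          simp only [p, Polynomial.finsetSum_coeff, Polynomial.coeff_monomial]
          rw [Finset.sum_eq_single m]
          · simp
          · intro b _ hb
            rw [if_neg]
            exact fun h => hb (Fin.ext h)
          · simp
        rw [← h1, hp]; simp
      have heval : ∀ x : ℝ, dotT (f k ω) (curve x) = p.eval (x : ℂ) := by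
        intro x
        simp [p, dotT, curve, Polynomial.eval_finsetSum]
      have hfin : Set.Finite {x : ℝ | dotT (f k ω) (curve x) = 0} := by
        refine Set.Finite.of_finite_image (f := fun x : ℝ => (x : ℂ)) ?_
          (fun x _ y _ h => Complex.ofReal_injective h)
        refine (p.roots.toFinset.finite_toSet).subset ?_
        rintro _ ⟨x, hx, rfl⟩
        change dotT (f k ω) (curve x) = 0 at hx
        rw [heval] at hx
        simpa [hp] using hx
      exact hfin.measure_zero volume
    have h1 : ∀ᵐ p ∂(volume.prod μ), dotT (f k (Prod.swap p).1) (curve (Prod.swap p).2) ≠ 0 := by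
      have h2 : ∀ᵐ p ∂(μ.prod (volume : Measure ℝ)), dotT (f k p.1) (curve p.2) ≠ 0 := by
        rw [ae_iff]; simpa using hnull
      exact (Measure.measurePreserving_swap (μ := (volume : Measure ℝ)) (ν := μ)
        ).quasiMeasurePreserving.ae h2
    exact Measure.ae_ae_of_ae_prod h1
  obtain ⟨x, hx⟩ := (ae_all_iff.2 key).exists
  exact ⟨curve x, hx⟩

/-! ### Zero forcing -/

/-- The vector `u` with its component along the conjugate of `g` removed, scaled by `‖g‖ ^ 2`. -/
def zeroForce {M : ℕ} (u g : Vec M) : Vec M := ((‖g‖ ^ 2 : ℝ) : ℂ) • u - dotT g u • conjV g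

theorem dotT_conjV {M : ℕ} (g : Vec M) : dotT g (conjV g) = ((‖g‖ ^ 2 : ℝ) : ℂ) := by
  rw [dotT_eq_inner, inner_self_eq_norm_sq_to_K, norm_conjV]; simp

theorem dotT_zeroForce {M : ℕ} (u g : Vec M) : dotT g (zeroForce u g) = 0 := by
  rw [zeroForce, dotT_sub, dotT_smul, dotT_smul, dotT_conjV]; ring

theorem measurable_zeroForce {M : ℕ} (u : Vec M) : Measurable (zeroForce u) := by
  unfold zeroForce
  have h1 : Measurable fun g : Vec M => dotT g u := measurable_dotT measurable_id measurable_const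
  have h2 : Measurable fun g : Vec M => ((‖g‖ ^ 2 : ℝ) : ℂ) := by fun_prop
  exact (h2.smul_const u).sub (h1.smul measurable_conjV)

theorem norm_zeroForce_le {M : ℕ} (u g : Vec M) : ‖zeroForce u g‖ ≤ 2 * ‖g‖ ^ 2 * ‖u‖ := by
  refine (norm_sub_le _ _).trans ?_
  rw [norm_smul, norm_smul, norm_conjV, Complex.norm_real, Real.norm_of_nonneg (by positivity)]
  have := mul_le_mul_of_nonneg_right (norm_dotT_le g u) (norm_nonneg g)
  nlinarith

theorem norm_zeroForce_sub_le {M : ℕ} (u g k : Vec M) :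
    ‖zeroForce u g - zeroForce u k‖ ≤ 2 * ‖u‖ * (‖g‖ + ‖k‖) * ‖g - k‖ := by
  have h1 : zeroForce u g - zeroForce u k =
      ((‖g‖ ^ 2 - ‖k‖ ^ 2 : ℝ) : ℂ) • u - (dotT (g - k) u • conjV g + dotT k u • conjV (g - k)) := by
    simp only [zeroForce, sub_dotT, conjV_sub, Complex.ofReal_sub, smul_sub, sub_smul]
    abel
  rw [h1]
  refine (norm_sub_le _ _).trans ?_
  have h2 : ‖((‖g‖ ^ 2 - ‖k‖ ^ 2 : ℝ) : ℂ) • u‖ ≤ ‖g - k‖ * (‖g‖ + ‖k‖) * ‖u‖ := by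
    rw [norm_smul, Complex.norm_real, Real.norm_eq_abs, sq_sub_sq, abs_mul,
      abs_of_nonneg (by positivity : 0 ≤ ‖g‖ + ‖k‖), mul_comm (‖g‖ + ‖k‖)]
    gcongr
    exact abs_norm_sub_norm_le g k
  have h3 : ‖dotT (g - k) u • conjV g + dotT k u • conjV (g - k)‖ ≤
      ‖g - k‖ * ‖u‖ * ‖g‖ + ‖k‖ * ‖u‖ * ‖g - k‖ := by
    refine (norm_add_le _ _).trans ?_
    rw [norm_smul, norm_smul, norm_conjV, norm_conjV]
    gcongr
    · exact norm_dotT_le _ _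
    · exact norm_dotT_le _ _
  linarith

/-- The determinant of the matrix of received coefficients of two beams. -/
def beamDet {M : ℕ} (h k b u : Vec M) : ℂ := dotT h b * dotT k u - dotT h u * dotT k b

theorem beamDet_eq {M : ℕ} (h k b u : Vec M) :
    beamDet h k b u = dotT (dotT k u • h - dotT h u • k) b := by
  rw [beamDet, sub_dotT, smul_dotT, smul_dotT]; ring

/-- The determinant is linear in the vector to be zero-forced, and the coefficient vector is, up to
a scalar, the component of `h` orthogonal to `k`. It is nonzero when `h`, `k` are independent and
`dotT k u ≠ 0`, so a generic `b` serves. -/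
theorem beamDet_zeroForce_eq {M : ℕ} (h k b u : Vec M) :
    beamDet h k (zeroForce b k) u =
      dotT (dotT k u • (((‖k‖ ^ 2 : ℝ) : ℂ) • h - dotT h (conjV k) • k)) b := by
  rw [beamDet, dotT_zeroForce, zeroForce, dotT_sub, dotT_smul, dotT_smul, smul_dotT, sub_dotT,
    smul_dotT, smul_dotT]
  ring

theorem norm_beamDet_sub_le {M : ℕ} (h k b b' u : Vec M) :
    ‖beamDet h k b u - beamDet h k b' u‖ ≤ 2 * ‖h‖ * ‖k‖ * ‖u‖ * ‖b - b'‖ := by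
  have h1 : beamDet h k b u - beamDet h k b' u =
      dotT h (b - b') * dotT k u - dotT h u * dotT k (b - b') := by
    simp only [beamDet, dotT_sub]; ring
  rw [h1]
  refine (norm_sub_le _ _).trans ?_
  rw [norm_mul, norm_mul]
  have h2 : ‖dotT h (b - b')‖ * ‖dotT k u‖ ≤ (‖h‖ * ‖b - b'‖) * (‖k‖ * ‖u‖) := by
    gcongr <;> exact norm_dotT_le _ _
  have h3 : ‖dotT h u‖ * ‖dotT k (b - b')‖ ≤ (‖h‖ * ‖u‖) * (‖k‖ * ‖b - b'‖) := by
    gcongr <;> exact norm_dotT_le _ _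
  linarith

theorem exists_generic_beams {Ω : Type*} [MeasurableSpace Ω] (μ : Measure Ω) [SFinite μ] {M : ℕ}
    (h : Channel Ω M) (hm : ∀ t i, Measurable (h t i))
    (hli : ∀ t, ∀ᵐ ω ∂μ, LinearIndependent ℂ (fun i : Fin 2 => h t i ω)) :
    ∃ u b : Vec M, ∀ t i, (∀ᵐ ω ∂μ, dotT (h t i ω) u ≠ 0) ∧
      (∀ᵐ ω ∂μ, beamDet (h t (1 - i) ω) (h t i ω) b u ≠ 0) ∧
      (∀ᵐ ω ∂μ, beamDet (h t (1 - i) ω) (h t i ω) (zeroForce b (h t i ω)) u ≠ 0) := by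
  have hpair : ∀ t (i : Fin 2), ∀ᵐ ω ∂μ, ∀ x y : ℂ,
      x • h t (1 - i) ω - y • h t i ω = 0 → x = 0 ∧ y = 0 := by
    intro t i
    filter_upwards [hli t] with ω hω x y hxy
    have h1 := Fintype.linearIndependent_iff.1 hω (fun k => if k = i then -y else x)
    rw [Fin.sum_univ_two] at h1
    fin_cases i
    · have h2 := h1 (by simpa [neg_smul, add_comm, sub_eq_add_neg] using hxy)
      exact ⟨by simpa using h2 1, by simpa using h2 0⟩
    · have h2 := h1 (by simpa [neg_smul, add_comm, sub_eq_add_neg] using hxy)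
      exact ⟨by simpa using h2 0, by simpa using h2 1⟩
  have hne : ∀ t i, ∀ᵐ ω ∂μ, h t i ω ≠ 0 := fun t i => (hli t).mono fun ω hω => hω.ne_zero i
  obtain ⟨u, hu⟩ := exists_generic_vec μ (fun p : ℕ × Fin 2 => h p.1 p.2)
    (fun p => hm _ _) (fun p => hne _ _)
  have hd : ∀ t i, Measurable fun ω => dotT (h t i ω) u := fun t i =>
    measurable_dotT (hm t i) measurable_const
  -- `b` is chosen after `u`, since both determinants are linear in `b` with coefficients that
  -- depend on `u`. The Boolean selects the plain or the zero-forced beam.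
  obtain ⟨b, hb⟩ := exists_generic_vec μ
    (fun (p : ℕ × Fin 2 × Bool) ω => if p.2.2 then
      dotT (h p.1 p.2.1 ω) u • h p.1 (1 - p.2.1) ω - dotT (h p.1 (1 - p.2.1) ω) u • h p.1 p.2.1 ω
      else dotT (h p.1 p.2.1 ω) u • (((‖h p.1 p.2.1 ω‖ ^ 2 : ℝ) : ℂ) • h p.1 (1 - p.2.1) ω -
        dotT (h p.1 (1 - p.2.1) ω) (conjV (h p.1 p.2.1 ω)) • h p.1 p.2.1 ω))
    (by
      rintro ⟨t, i, c⟩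
      cases c
      · simp only [Bool.false_eq_true, if_false]
        have h1 : Measurable fun ω => ((‖h t i ω‖ ^ 2 : ℝ) : ℂ) :=
          Complex.measurable_ofReal.comp ((hm t i).norm.pow_const 2)
        exact (hd t i).smul ((h1.smul (hm t (1 - i))).sub
          ((measurable_dotT (hm t (1 - i)) (measurable_conjV.comp (hm t i))).smul (hm t i)))
      · simp only [if_true]
        exact ((hd t i).smul (hm t (1 - i))).sub ((hd t (1 - i)).smul (hm t i)))
    (by
      rintro ⟨t, i, c⟩
      filter_upwards [hpair t i, hu (t, i), hne t i] with ω h1 h2 h3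
      cases c
      · simp only [Bool.false_eq_true, if_false]
        refine smul_ne_zero h2 fun h4 => h3 ?_
        simpa using (h1 _ _ h4).1
      · simp only [if_true]
        exact fun h4 => h2 (h1 _ _ h4).1)
  refine ⟨u, b, fun t i => ⟨hu (t, i), ?_, ?_⟩⟩
  · filter_upwards [hb (t, i, true)] with ω hω
    simpa [beamDet_eq] using hω
  · filter_upwards [hb (t, i, false)] with ω hω
    simpa [beamDet_zeroForce_eq] using hω

/-! ### Expansions with guarded digits -/

theorem sum_quarter_mul_pow_le {R : ℝ} (hR : 2 ≤ R) (m : ℕ) :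
    ∑ l ∈ Finset.range m, R / 4 * R ^ l ≤ R ^ m / 2 := by
  induction m with
  | zero => simp
  | succ m ih =>
    rw [Finset.sum_range_succ, pow_succ]
    have : 0 < R ^ m := by positivity
    nlinarith

/-- The highest level `L` with differing digits contributes at least `R ^ L`, while digit
differences of at most `R / 4` keep all lower levels below `R ^ L / 2`. An uncertainty below `R ^ k
/ 2` thus leaves the digits from level `k` upwards intact. -/
theorem digits_eq_of_abs_sum_lt {R : ℝ} (hR : 2 ≤ R) {q : ℕ} (hq : 4 * (q : ℝ) ≤ R)
    {x y : ℕ → ℕ} (hx : ∀ l, x l < q) (hy : ∀ l, y l < q) {k : ℕ} (L : ℕ)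
    (hlt : |∑ l ∈ Finset.range L, ((x l : ℝ) - y l) * R ^ l| < R ^ k / 2) :
    ∀ l, k ≤ l → l < L → x l = y l := by
  induction L with
  | zero => intro l _ hl; omega
  | succ L ih =>
    intro l hkl hl
    have habs : ∀ l, |(x l : ℝ) - y l| ≤ R / 4 := by
      intro l
      have h1 : (x l : ℝ) ≤ q := by exact_mod_cast (hx l).le
      have h2 : (y l : ℝ) ≤ q := by exact_mod_cast (hy l).le
      have h3 : (0 : ℝ) ≤ x l := by positivity
      have h4 : (0 : ℝ) ≤ y l := by positivity
      rw [abs_le]; constructor <;> linarith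
    have htop : x L = y L := by
      by_contra hne
      have h1 : (1 : ℝ) ≤ |(x L : ℝ) - y L| := by
        have : (1 : ℤ) ≤ |(x L : ℤ) - y L| := Int.one_le_abs (by omega)
        exact_mod_cast this
      have h2 : |∑ l ∈ Finset.range L, ((x l : ℝ) - y l) * R ^ l| ≤ R ^ L / 2 := by
        refine (Finset.abs_sum_le_sum_abs _ _).trans
          ((Finset.sum_le_sum fun l _ => ?_).trans (sum_quarter_mul_pow_le hR L))
        rw [abs_mul, abs_of_nonneg (by positivity : 0 ≤ R ^ l)]
        exact mul_le_mul_of_nonneg_right (habs l) (by positivity)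
      have h3 : R ^ L ≤ |((x L : ℝ) - y L) * R ^ L| := by
        rw [abs_mul, abs_of_nonneg (by positivity : 0 ≤ R ^ L)]
        nlinarith [pow_pos (by linarith : 0 < R) L]
      have h4 : R ^ k ≤ R ^ L := pow_le_pow_right₀ (by linarith) (by omega)
      rw [Finset.sum_range_succ] at hlt
      have h5 := abs_sub_abs_le_abs_sub (((x L : ℝ) - y L) * R ^ L)
        (-(∑ l ∈ Finset.range L, ((x l : ℝ) - y l) * R ^ l))
      rw [abs_neg, sub_neg_eq_add, add_comm (((x L : ℝ) - y L) * R ^ L)] at h5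
      linarith
    rcases Nat.lt_succ_iff_lt_or_eq.1 hl with h | h
    · refine ih ?_ l hkl h
      rw [Finset.sum_range_succ, htop, sub_self, zero_mul, add_zero] at hlt
      exact hlt
    · rw [h]; exact htop

/-! ### Repeating symbols so that two index sets both see all of them -/

/-- The levels above the private signal differ between the users, yet both must read every common
symbol. With `S` and `T` cut down to `K` elements, the parts outside the intersection have equal
size and can be matched, and matched positions carry the same symbol; no erasure code is needed. -/
theorem exists_map_surjOn_two {X : Type*} [DecidableEq X] (S T : Finset X) {K : ℕ}
    (hK : 0 < K) (hS : K ≤ S.card) (hT : K ≤ T.card) :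
    ∃ r : X → Fin K, (∀ k, ∃ p ∈ S, r p = k) ∧ ∀ k, ∃ p ∈ T, r p = k := by
  classical
  obtain ⟨S', hSS, hS'⟩ := Finset.exists_subset_card_eq hS
  obtain ⟨T', hTT, hT'⟩ := Finset.exists_subset_card_eq hT
  have e : S' ≃ Fin K := S'.equivFinOfCardEq hS'
  have hcard : (T' \ S').card = (S' \ T').card := by
    have h1 := Finset.card_sdiff_add_card_inter T' S'
    have h2 := Finset.card_sdiff_add_card_inter S' T'
    rw [Finset.inter_comm] at h2
    omega
  have f : (T' \ S' : Finset X) ≃ (S' \ T' : Finset X) := Finset.equivOfCardEq hcard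
  have hmem : ∀ x : (S' \ T' : Finset X), (x : X) ∈ S' := fun x => (Finset.mem_sdiff.1 x.2).1
  let r : X → Fin K := fun p => if hp : p ∈ S' then e ⟨p, hp⟩ else
    if hp' : p ∈ T' \ S' then e ⟨f ⟨p, hp'⟩, hmem _⟩ else ⟨0, hK⟩
  have hr1 : ∀ p (hp : p ∈ S'), r p = e ⟨p, hp⟩ := fun p hp => by simp only [r, dif_pos hp]
  have hr2 : ∀ p (hp : p ∈ T' \ S'), r p = e ⟨f ⟨p, hp⟩, hmem _⟩ := fun p hp => by
    simp only [r, dif_neg (Finset.mem_sdiff.1 hp).2, dif_pos hp]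
  refine ⟨r, fun k => ⟨e.symm k, hSS (e.symm k).2, ?_⟩, fun k => ?_⟩
  · rw [hr1 _ (e.symm k).2]; simp
  · by_cases hk : (e.symm k : X) ∈ T'
    · refine ⟨e.symm k, hTT hk, ?_⟩
      rw [hr1 _ (e.symm k).2]; simp
    · have h1 : (e.symm k : X) ∈ S' \ T' := Finset.mem_sdiff.2 ⟨(e.symm k).2, hk⟩
      refine ⟨f.symm ⟨_, h1⟩, hTT (Finset.mem_sdiff.1 (f.symm ⟨_, h1⟩).2).1, ?_⟩
      rw [hr2 _ (f.symm ⟨_, h1⟩).2]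
      simp

/-! ### Allocation of power and rate exponents -/

/-- Private powers `δ` between a degraded current quality and the delayed quality `b`, of prescribed
mean. -/
theorem exists_power_exponents {Tc : ℕ} (hTc : 0 < Tc) {α : ℕ → ℝ} {b d : ℝ}
    (h0 : ∀ j, 0 ≤ α j) (hb : ∀ j, α j ≤ b) (hd : 1 / 2 ≤ d) (hd1 : d < 1)
    (hα : (3 * d - 2) * Tc < ∑ j ∈ Finset.range Tc, α j) (hdb : 2 * d - 1 ≤ b) :
    ∃ α' δ : ℕ → ℝ, (∀ j, 0 ≤ α' j) ∧ (∀ j, α' j ≤ α j) ∧ (∀ j, α' j ≤ δ j) ∧ (∀ j, δ j ≤ b) ∧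
      ∑ j ∈ Finset.range Tc, δ j = (2 * d - 1) * Tc ∧
      (3 * d - 2) * Tc < ∑ j ∈ Finset.range Tc, α' j := by
  have hT : (0 : ℝ) < Tc := by exact_mod_cast hTc
  -- If the mean of `α` exceeds `2d - 1`, it is scaled down to that value. The strict bound survives
  -- since `3d - 2 < 2d - 1` for `d < 1`.
  obtain ⟨lam, hl0, hl1, hsum, hgt⟩ : ∃ lam : ℝ, 0 ≤ lam ∧ lam ≤ 1 ∧
      lam * ∑ j ∈ Finset.range Tc, α j ≤ (2 * d - 1) * Tc ∧
      (3 * d - 2) * Tc < lam * ∑ j ∈ Finset.range Tc, α j := by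
    by_cases hle : ∑ j ∈ Finset.range Tc, α j ≤ (2 * d - 1) * Tc
    · exact ⟨1, zero_le_one, le_rfl, by simpa using hle, by simpa using hα⟩
    · push Not at hle
      have hD : 0 ≤ (2 * d - 1) * Tc := mul_nonneg (by linarith) hT.le
      have hpos : 0 < ∑ j ∈ Finset.range Tc, α j := lt_of_le_of_lt hD hle
      refine ⟨(2 * d - 1) * Tc / ∑ j ∈ Finset.range Tc, α j, by positivity, ?_, ?_, ?_⟩
      · rw [div_le_one hpos]; exact hle.le
      · rw [div_mul_cancel₀ _ hpos.ne']
      · rw [div_mul_cancel₀ _ hpos.ne']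
        nlinarith
  have hle : ∀ j, lam * α j ≤ α j := fun j => mul_le_of_le_one_left (h0 j) hl1
  set m := lam * ∑ j ∈ Finset.range Tc, α j with hm
  have hmb : m ≤ b * Tc := hsum.trans (mul_le_mul_of_nonneg_right hdb hT.le)
  -- `δ` is the convex combination of the degraded `α` and the constant `b` whose mean is exactly
  -- `2d - 1`.
  obtain ⟨θ, hθ0, hθ1, hθ⟩ : ∃ θ : ℝ, 0 ≤ θ ∧ θ ≤ 1 ∧
      m + θ * (b * Tc - m) = (2 * d - 1) * Tc := by
    by_cases heq : b * Tc - m = 0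
    · refine ⟨0, le_rfl, zero_le_one, ?_⟩
      have := mul_le_mul_of_nonneg_right hdb hT.le
      linarith
    · have hpos : 0 < b * Tc - m := lt_of_le_of_ne (by linarith) (Ne.symm heq)
      refine ⟨((2 * d - 1) * Tc - m) / (b * Tc - m), div_nonneg (by linarith) hpos.le, ?_, ?_⟩
      · rw [div_le_one hpos]
        have := mul_le_mul_of_nonneg_right hdb hT.le
        linarith
      · rw [div_mul_cancel₀ _ heq]; ring
  refine ⟨fun j => lam * α j, fun j => lam * α j + θ * (b - lam * α j),
    fun j => mul_nonneg hl0 (h0 j), hle, fun j => ?_, fun j => ?_, ?_, ?_⟩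
  · have : 0 ≤ b - lam * α j := by linarith [hle j, hb j]
    nlinarith
  · have : 0 ≤ b - lam * α j := by linarith [hle j, hb j]
    nlinarith
  · rw [Finset.sum_add_distrib, ← Finset.mul_sum, ← Finset.mul_sum, Finset.sum_sub_distrib,
      ← Finset.mul_sum, ← hm, ← hθ]
    simp [mul_comm]
  · rw [← Finset.mul_sum]; exact hgt

theorem natCast_floor_tsub_bounds {x : ℝ} (hx : 0 ≤ x) (c : ℕ) :
    x - c - 1 ≤ ((⌊x⌋₊ - c : ℕ) : ℝ) ∧ ((⌊x⌋₊ - c : ℕ) : ℝ) ≤ x ∧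
      ((⌊x⌋₊ - c : ℕ) = 0 ∨ ((⌊x⌋₊ - c : ℕ) : ℝ) + c ≤ x) := by
  have h1 := Nat.floor_le hx
  have h2 := Nat.lt_floor_add_one x
  by_cases hc : ⌊x⌋₊ ≤ c
  · have h3 : (⌊x⌋₊ - c : ℕ) = 0 := by omega
    have h4 : (⌊x⌋₊ : ℝ) ≤ c := by exact_mod_cast hc
    rw [h3]
    refine ⟨?_, by simpa using hx, Or.inl rfl⟩
    push_cast; linarith
  · rw [Nat.cast_sub (by omega)]
    have : (0 : ℝ) ≤ c := by positivity
    exact ⟨by linarith, by linarith, Or.inr (by linarith)⟩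

/-- Numbers of digits: `D v j` and `D v j - a v j` for the two private symbols sent against user `v`
in slot `j` of a coherence period, `f v` fresh digits, and `K` common symbols. -/
theorem exists_digit_allocation {Tc : ℕ} (hTc : 0 < Tc) {α : Fin 2 → ℕ → ℝ} {β : Fin 2 → ℝ}
    {d : ℝ} (h0 : ∀ v j, 0 ≤ α v j) (hb : ∀ v j, α v j ≤ β v) (hd : 1 / 2 ≤ d) (hd1 : d < 1)
    (hα : ∀ v, (3 * d - 2) * Tc < ∑ j ∈ Finset.range Tc, α v j) (hdb : ∀ v, 2 * d - 1 ≤ β v) :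
    ∀ᶠ N : ℕ in atTop, ∃ (D a : Fin 2 → ℕ → ℕ) (f : Fin 2 → ℕ) (K : ℕ), 0 < K ∧
      (∀ v j, a v j ≤ D v j) ∧ (∀ v j, D v j = 0 ∨ (D v j : ℝ) + 20 ≤ N * β v) ∧
      (∀ v j, a v j = 0 ∨ (a v j : ℝ) + 20 ≤ N * α v j) ∧
      (∑ v, ∑ j ∈ Finset.range Tc, 2 * (D v j - a v j + 18) + ∑ v, f v ≤ 2 * K) ∧
      (∀ v, K ≤ ∑ j ∈ Finset.range Tc, (N - 23 - D v j)) ∧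
      ∀ v, 2 * N * Tc * d - 187 * Tc ≤
        ((∑ j ∈ Finset.range Tc, 2 * (D v j + (D v j - a v j)) + f v : ℕ) : ℝ) := by
  have hT : (1 : ℝ) ≤ Tc := by exact_mod_cast hTc
  choose α' δ hα0 hαα hαδ hδb hδs hαs using fun v =>
    exists_power_exponents hTc (h0 v) (hb v) hd hd1 (hα v) (hdb v)
  have hδ0 : ∀ v j, 0 ≤ δ v j := fun v j => (hα0 v j).trans (hαδ v j)
  have hev : ∀ c x : ℝ, 0 < x → ∀ᶠ N : ℕ in atTop, c ≤ N * x := by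
    intro c x hx
    exact (tendsto_natCast_atTop_atTop.atTop_mul_const hx).eventually_ge_atTop c
  have hfr : ∀ v, 0 < 2 * (Tc * d - 2 * ((2 * d - 1) * Tc) + ∑ j ∈ Finset.range Tc, α' v j) := by
    intro v
    have := hαs v
    linarith
  filter_upwards [hev (23 * Tc + 2) (Tc * (2 - 2 * d)) (by nlinarith),
    hev (102 * Tc + 1) _ (hfr 0), hev (102 * Tc + 1) _ (hfr 1)] with N hN hN0 hN1
  have hN' : (0 : ℝ) ≤ N := by positivity
  have hNf : ∀ v : Fin 2, (102 * Tc + 1 : ℝ) ≤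
      N * (2 * (Tc * d - 2 * ((2 * d - 1) * Tc) + ∑ j ∈ Finset.range Tc, α' v j)) := by
    intro v; fin_cases v
    · exact hN0
    · exact hN1
  -- The `20` levels withheld from `D` and `a` are the slack left for the estimation errors.
  set D : Fin 2 → ℕ → ℕ := fun v j => ⌊N * δ v j⌋₊ - 20 with hD
  set a : Fin 2 → ℕ → ℕ := fun v j => ⌊N * α' v j⌋₊ - 20 with ha
  -- Here `102 = 78 + 23 + 1` per slot: rounding and the `18` guard digits of the quantised
  -- disturbances cost `78`, the lost common levels `23`, and the floor in `K` at most `1`.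
  set f : Fin 2 → ℕ := fun v => ⌊N * (2 * (Tc * d - 2 * ((2 * d - 1) * Tc) +
    ∑ j ∈ Finset.range Tc, α' v j))⌋₊ - 102 * Tc with hf
  set K : ℕ := ⌊N * (Tc * (2 - 2 * d))⌋₊ - 23 * Tc with hK
  have hDb : ∀ v j, _ := fun v j => natCast_floor_tsub_bounds (mul_nonneg hN' (hδ0 v j)) 20
  have hab : ∀ v j, _ := fun v j => natCast_floor_tsub_bounds (mul_nonneg hN' (hα0 v j)) 20
  have hKb := natCast_floor_tsub_bounds (x := N * (Tc * (2 - 2 * d))) (by linarith) (23 * Tc)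
  have hfb : ∀ v, _ := fun v => natCast_floor_tsub_bounds
    (x := N * (2 * (Tc * d - 2 * ((2 * d - 1) * Tc) + ∑ j ∈ Finset.range Tc, α' v j)))
    (by linarith [hNf v]) (102 * Tc)
  push_cast at hDb hab hKb hfb
  have haD : ∀ v j, a v j ≤ D v j := by
    intro v j
    exact Nat.sub_le_sub_right (Nat.floor_le_floor (mul_le_mul_of_nonneg_left (hαδ v j) hN')) 20
  have hKpos : (0 : ℝ) < (K : ℝ) := by
    have := hKb.1
    simp only [hK]; linarith
  have hKu : (K : ℝ) + 23 * Tc ≤ N * (Tc * (2 - 2 * d)) := by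
    rcases hKb.2.2 with h | h
    · exfalso
      have : K = 0 := h
      rw [this] at hKpos; simp at hKpos
    · exact h
  have hfu : ∀ v, (f v : ℝ) + 102 * Tc ≤ N * (2 * (Tc * d - 2 * ((2 * d - 1) * Tc) +
      ∑ j ∈ Finset.range Tc, α' v j)) := by
    intro v
    rcases (hfb v).2.2 with h | h
    · have h1 : f v = 0 := h
      rw [h1]
      have := hNf v
      push_cast; linarith
    · exact h
  have hDa : ∀ v j, ((D v j - a v j : ℕ) : ℝ) = D v j - a v j := fun v j => Nat.cast_sub (haD v j)
  refine ⟨D, a, f, K, by exact_mod_cast hKpos, haD, ?_, ?_, ?_, ?_, ?_⟩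
  · intro v j
    refine (hDb v j).2.2.imp id fun h => h.trans ?_
    exact mul_le_mul_of_nonneg_left (hδb v j) hN'
  · intro v j
    refine (hab v j).2.2.imp id fun h => h.trans ?_
    exact mul_le_mul_of_nonneg_left (hαα v j) hN'
  · have h1 : ∀ v, ((∑ j ∈ Finset.range Tc, 2 * (D v j - a v j + 18) : ℕ) : ℝ) ≤
        2 * N * ((2 * d - 1) * Tc) - 2 * N * ∑ j ∈ Finset.range Tc, α' v j + 78 * Tc := by
      intro v
      have h2 : ((∑ j ∈ Finset.range Tc, 2 * (D v j - a v j + 18) : ℕ) : ℝ) ≤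
          ∑ j ∈ Finset.range Tc, (2 * N * δ v j - 2 * N * α' v j + 78) := by
        push_cast
        refine Finset.sum_le_sum fun j _ => ?_
        rw [hDa]
        have := (hDb v j).2.1
        have := (hab v j).1
        simp only [hD, ha]
        linarith
      refine h2.trans (le_of_eq ?_)
      rw [Finset.sum_add_distrib, Finset.sum_sub_distrib, ← Finset.mul_sum, ← Finset.mul_sum,
        hδs v]
      simp [mul_comm]
    have hgoal : ((∑ v, ∑ j ∈ Finset.range Tc, 2 * (D v j - a v j + 18) + ∑ v, f v : ℕ) : ℝ) ≤
        ((2 * K : ℕ) : ℝ) := by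
      rw [Fin.sum_univ_two, Fin.sum_univ_two]
      rw [Nat.cast_add, Nat.cast_add, Nat.cast_add, Nat.cast_mul]
      have e0 := h1 0
      have e1 := h1 1
      have e2 := hfu 0
      have e3 := hfu 1
      have e4 := hKb.1
      have e5 : N * (Tc * (2 - 2 * d)) - 23 * Tc - 1 ≤ (K : ℝ) := e4
      push_cast at *
      linarith
    exact_mod_cast hgoal
  · intro v
    have h2 : (K : ℝ) ≤ ((∑ j ∈ Finset.range Tc, (N - 23 - D v j) : ℕ) : ℝ) := by
      have h3 : ∑ j ∈ Finset.range Tc, ((N : ℝ) - 23 - N * δ v j) ≤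
          ((∑ j ∈ Finset.range Tc, (N - 23 - D v j) : ℕ) : ℝ) := by
        push_cast
        refine Finset.sum_le_sum fun j _ => ?_
        have h4 : N ≤ (N - 23 - D v j) + 23 + D v j := by omega
        have h5 : (N : ℝ) ≤ ((N - 23 - D v j : ℕ) : ℝ) + 23 + D v j := by exact_mod_cast h4
        have h6 : (D v j : ℝ) ≤ N * δ v j := (hDb v j).2.1
        linarith
      refine le_trans ?_ h3
      rw [Finset.sum_sub_distrib, ← Finset.mul_sum, hδs v]
      simp only [Finset.sum_const, Finset.card_range, nsmul_eq_mul]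
      linarith
    exact_mod_cast h2
  -- The loss is `84` per slot from rounding the private digits, `102` from the fresh digits, and
  -- one final floor: at most `187 * Tc` in all.
  · intro v
    have h2 : ∑ j ∈ Finset.range Tc, (4 * N * δ v j - 2 * N * α' v j - 84) ≤
        ((∑ j ∈ Finset.range Tc, 2 * (D v j + (D v j - a v j)) : ℕ) : ℝ) := by
      push_cast
      refine Finset.sum_le_sum fun j _ => ?_
      rw [hDa]
      have h3 : N * δ v j - 20 - 1 ≤ (D v j : ℝ) := (hDb v j).1
      have h4 : (a v j : ℝ) ≤ N * α' v j := (hab v j).2.1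
      linarith
    rw [Finset.sum_sub_distrib, Finset.sum_sub_distrib, ← Finset.mul_sum, ← Finset.mul_sum,
      hδs v] at h2
    simp only [Finset.sum_const, Finset.card_range, nsmul_eq_mul] at h2
    have h5 := (hfb v).1
    have h6 : N * (2 * (Tc * d - 2 * ((2 * d - 1) * Tc) + ∑ j ∈ Finset.range Tc, α' v j))
      - 102 * Tc - 1 ≤ (f v : ℝ) := h5
    rw [Nat.cast_add]
    linarith

/-! ### Bounds for one slot -/

/-- Zero-forcing at the estimate `c` leaks only through `k - c`. The map `zeroForce b` is Lipschitz
on bounded sets, so the determinant for the true channel `k`, bounded below almost surely in the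
limit, changes by less than half of its guaranteed size. If `a = 0`, nothing is known about `c` and
the plain beam `b` is used. -/
theorem beam_bounds {M : ℕ} {R : ℝ} (hR : 100 ≤ R) {h k c u b : Vec M} {a : ℕ}
    (hh : ‖h‖ ≤ R) (hk : ‖k‖ ≤ R) (hu : ‖u‖ ≤ R) (hb : ‖b‖ ≤ R)
    (hc : a = 0 ∨ ‖k - c‖ * R ^ (a + 20) ≤ R)
    (hd : 2 ≤ R * ‖beamDet h k b u‖) (hz : 2 ≤ R * ‖beamDet h k (zeroForce b k) u‖) {v : Vec M}
    (hv : v = if a = 0 then b else zeroForce b c) :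
    ‖v‖ ≤ R ^ 4 ∧ ‖dotT k v‖ * R ^ a ≤ R ^ 2 ∧ 1 ≤ R * ‖beamDet h k v u‖ := by
  have hR0 : 0 < R := by linarith
  by_cases ha : a = 0
  · rw [if_pos ha] at hv
    subst ha hv
    refine ⟨hb.trans ?_, ?_, by linarith⟩
    · calc R = R ^ 1 := (pow_one R).symm
        _ ≤ R ^ 4 := pow_le_pow_right₀ (by linarith) (by norm_num)
    · rw [pow_zero, mul_one, sq]
      exact (norm_dotT_le _ _).trans (mul_le_mul hk hb (norm_nonneg _) hR0.le)
  · rw [if_neg ha] at hv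
    have hc := hc.resolve_left ha
    have hkc : ‖k - c‖ * R ^ a * R ^ 19 ≤ 1 := by
      have h1 : ‖k - c‖ * R ^ (a + 20) = ‖k - c‖ * R ^ a * R ^ 19 * R := by ring
      rw [h1] at hc
      exact le_of_mul_le_mul_right (by linarith) hR0
    have hRa : 1 ≤ R ^ a := one_le_pow₀ (by linarith)
    have hkc' : ‖k - c‖ * R ^ 19 ≤ 1 := by
      refine le_trans ?_ hkc
      have : 0 ≤ ‖k - c‖ * R ^ 19 := by positivity
      nlinarith
    have hR19 : 1 ≤ R ^ 19 := one_le_pow₀ (by linarith)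
    have hkc1 : ‖k - c‖ ≤ 1 := by
      refine le_trans ?_ hkc'
      exact le_mul_of_one_le_right (norm_nonneg _) hR19
    have hcn : ‖c‖ ≤ 2 * R := by
      have := norm_sub_norm_le c k
      rw [norm_sub_rev] at this
      linarith
    have hvn : ‖v‖ ≤ R ^ 4 := by
      rw [hv]
      refine (norm_zeroForce_le b c).trans ?_
      calc 2 * ‖c‖ ^ 2 * ‖b‖ ≤ 2 * (2 * R) ^ 2 * R := by gcongr
        _ = 8 * R ^ 3 := by ring
        _ ≤ R * R ^ 3 := by gcongr; linarith
        _ = R ^ 4 := by ring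
    refine ⟨hvn, ?_, ?_⟩
    · have h1 : dotT k v = dotT (k - c) v := by
        rw [sub_dotT, hv, dotT_zeroForce, sub_zero]
      have h2 : ‖dotT k v‖ ≤ ‖k - c‖ * R ^ 4 := by
        rw [h1]
        exact (norm_dotT_le _ _).trans (by gcongr)
      calc ‖dotT k v‖ * R ^ a ≤ ‖k - c‖ * R ^ 4 * R ^ a := by gcongr
        _ = ‖k - c‖ * R ^ a * R ^ 4 := by ring
        _ ≤ ‖k - c‖ * R ^ a * R ^ 19 := by gcongr <;> linarith
        _ ≤ 1 := hkc
        _ ≤ R ^ 2 := one_le_pow₀ (by linarith)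
    · have h1 := norm_beamDet_sub_le h k (zeroForce b k) v u
      have h2 : ‖zeroForce b k - v‖ ≤ 6 * R ^ 2 * ‖k - c‖ := by
        rw [hv]
        refine (norm_zeroForce_sub_le b k c).trans ?_
        calc 2 * ‖b‖ * (‖k‖ + ‖c‖) * ‖k - c‖ ≤ 2 * R * (R + 2 * R) * ‖k - c‖ := by gcongr
          _ = 6 * R ^ 2 * ‖k - c‖ := by ring
      have h3 : R * ‖beamDet h k (zeroForce b k) u - beamDet h k v u‖ ≤ 1 := by
        calc R * ‖beamDet h k (zeroForce b k) u - beamDet h k v u‖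
            ≤ R * (2 * ‖h‖ * ‖k‖ * ‖u‖ * ‖zeroForce b k - v‖) := by gcongr
          _ ≤ R * (2 * R * R * R * (6 * R ^ 2 * ‖k - c‖)) := by gcongr
          _ = ‖k - c‖ * (12 * R ^ 6) := by ring
          _ ≤ ‖k - c‖ * (R * R ^ 6) := by gcongr; linarith
          _ = ‖k - c‖ * R ^ 7 := by ring
          _ ≤ ‖k - c‖ * R ^ 19 := by gcongr <;> linarith
          _ ≤ 1 := hkc'
      have h4 := norm_sub_norm_le (beamDet h k (zeroForce b k) u) (beamDet h k v u)
      have h5 := mul_le_mul_of_nonneg_left h4 hR0.le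
      rw [mul_sub] at h5
      linarith

/-- At the unintended receiver the first symbol is weakened by `R ^ a`, and the second has `a` fewer
digits, so the two arrive at the same level `D - a`. -/
theorem beam_sum_bounds {M : ℕ} {R : ℝ} (hR : 100 ≤ R) {k u v : Vec M} {x y : ℂ} {a D : ℕ}
    (haD : a ≤ D) (hk : ‖k‖ ≤ R) (hu : ‖u‖ ≤ R) (hv : ‖v‖ ≤ R ^ 4)
    (hkv : ‖dotT k v‖ * R ^ a ≤ R ^ 2) (hx : ‖x‖ ≤ 2 * R ^ D) (hy : ‖y‖ ≤ 2 * R ^ (D - a)) :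
    ‖x • v + y • u‖ ≤ R ^ (D + 5) ∧ ‖dotT k (x • v + y • u)‖ ≤ R ^ (D - a + 3) := by
  have hR0 : 0 < R := by linarith
  have hDa : R ^ (D - a) ≤ R ^ D := pow_le_pow_right₀ (by linarith) (by omega)
  constructor
  · refine (norm_add_le _ _).trans ?_
    rw [norm_smul, norm_smul]
    calc ‖x‖ * ‖v‖ + ‖y‖ * ‖u‖ ≤ 2 * R ^ D * R ^ 4 + 2 * R ^ D * R := by
          gcongr
          exact hy.trans (by gcongr)
      _ ≤ 2 * R ^ D * R ^ 4 + 2 * R ^ D * R ^ 4 := by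
          gcongr
          calc R = R ^ 1 := (pow_one R).symm
            _ ≤ R ^ 4 := pow_le_pow_right₀ (by linarith) (by norm_num)
      _ = 4 * (R ^ D * R ^ 4) := by ring
      _ ≤ R * (R ^ D * R ^ 4) := by gcongr; linarith
      _ = R ^ (D + 5) := by ring
  · rw [dotT_add, dotT_smul, dotT_smul]
    refine (norm_add_le _ _).trans ?_
    rw [norm_mul, norm_mul]
    have hsplit : R ^ D = R ^ (D - a) * R ^ a := by rw [← pow_add]; congr 1; omega
    have h1 : ‖x‖ * ‖dotT k v‖ ≤ 2 * R ^ (D - a) * R ^ 2 := by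
      calc ‖x‖ * ‖dotT k v‖ ≤ 2 * R ^ D * ‖dotT k v‖ := by gcongr
        _ = 2 * R ^ (D - a) * (‖dotT k v‖ * R ^ a) := by rw [hsplit]; ring
        _ ≤ 2 * R ^ (D - a) * R ^ 2 := by gcongr
    have h2 : ‖y‖ * ‖dotT k u‖ ≤ 2 * R ^ (D - a) * R ^ 2 := by
      have : ‖dotT k u‖ ≤ R ^ 2 := by
        rw [sq]; exact (norm_dotT_le _ _).trans (mul_le_mul hk hu (norm_nonneg _) hR0.le)
      gcongr
    calc ‖x‖ * ‖dotT k v‖ + ‖y‖ * ‖dotT k u‖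
        ≤ 2 * R ^ (D - a) * R ^ 2 + 2 * R ^ (D - a) * R ^ 2 := add_le_add h1 h2
      _ = 4 * (R ^ (D - a) * R ^ 2) := by ring
      _ ≤ R * (R ^ (D - a) * R ^ 2) := by gcongr; linarith
      _ = R ^ (D - a + 3) := by ring

/-- The error is at most `R ^ (-(D + 19))` and the signal at most `R ^ (D + 5)`; their product `R ^
(-14)` is below the quantiser step. -/
theorem delayed_residual_le {M : ℕ} {R : ℝ} (hR : 100 ≤ R) {k g p : Vec M} {D : ℕ}
    (hg : p = 0 ∨ ‖k - g‖ * R ^ (D + 20) ≤ R) (hp : ‖p‖ ≤ R ^ (D + 5)) :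
    R ^ 12 * ‖dotT (k - g) p‖ ≤ 1 := by
  have hR0 : 0 < R := by linarith
  rcases hg with rfl | hg
  · simp [dotT_zero]
  · have h1 : ‖k - g‖ * R ^ (D + 5) * R ^ 14 ≤ 1 := by
      have h1 : ‖k - g‖ * R ^ (D + 20) = ‖k - g‖ * R ^ (D + 5) * R ^ 14 * R := by ring
      rw [h1] at hg
      exact le_of_mul_le_mul_right (by linarith) hR0
    calc R ^ 12 * ‖dotT (k - g) p‖ ≤ R ^ 12 * (‖k - g‖ * R ^ (D + 5)) := by
          gcongr
          exact (norm_dotT_le _ _).trans (by gcongr)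
      _ = ‖k - g‖ * R ^ (D + 5) * R ^ 12 := by ring
      _ ≤ ‖k - g‖ * R ^ (D + 5) * R ^ 14 := by gcongr <;> linarith
      _ ≤ 1 := h1

/-- The two-dimensional quantiser with step `R ^ (-12)`, modulo `m`. -/
def quantise (R : ℝ) (m : ℕ) (x : ℂ) : ZMod m × ZMod m :=
  (((⌊R ^ 12 * x.re⌋ : ℤ) : ZMod m), ((⌊R ^ 12 * x.im⌋ : ℤ) : ZMod m))

theorem measurable_quantise (R : ℝ) (m : ℕ) [MeasurableSpace (ZMod m)] :
    Measurable (quantise R m) := by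
  have h1 : Measurable fun x : ℂ => ((⌊R ^ 12 * x.re⌋ : ℤ) : ZMod m) :=
    (measurable_of_countable (fun z : ℤ => (z : ZMod m))).comp
      (Int.measurable_floor.comp (Complex.measurable_re.const_mul _))
  have h2 : Measurable fun x : ℂ => ((⌊R ^ 12 * x.im⌋ : ℤ) : ZMod m) :=
    (measurable_of_countable (fun z : ℤ => (z : ZMod m))).comp
      (Int.measurable_floor.comp (Complex.measurable_im.const_mul _))
  exact h1.prodMk h2

theorem abs_sub_lt_one_of_floor_zmod {m : ℕ} {x y : ℝ}
    (hxy : ((⌊x⌋ : ℤ) : ZMod m) = ((⌊y⌋ : ℤ) : ZMod m)) (hlt : |x - y| + 1 ≤ m) : |x - y| < 1 := by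
  have hfl : |((⌊x⌋ - ⌊y⌋ : ℤ) : ℝ)| < m := by
    have h1 := Int.floor_le x
    have h2 := Int.lt_floor_add_one x
    have h3 := Int.floor_le y
    have h4 := Int.lt_floor_add_one y
    have h5 := abs_le.1 (le_refl |x - y|)
    push_cast
    rw [abs_lt]; constructor <;> linarith
  have hdvd : (m : ℤ) ∣ ⌊x⌋ - ⌊y⌋ := (ZMod.intCast_eq_intCast_iff_dvd_sub _ _ _).1 hxy.symm
  have hzero : ⌊x⌋ - ⌊y⌋ = 0 := by
    refine Int.eq_zero_of_abs_lt_dvd hdvd ?_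
    exact_mod_cast hfl
  exact Int.abs_sub_lt_one_of_floor_eq_floor (by omega)

/-- Reduction modulo `m` keeps the alphabet finite without clipping. No ambiguity arises, because
only values within `R ^ e` of each other compete and `m` exceeds the number of steps in that range.
-/
theorem norm_sub_le_of_quantise_eq {R : ℝ} (hR : 100 ≤ R) {m e : ℕ} (hm : R ^ (e + 13) < m)
    {x y : ℂ} (hxy : quantise R m x = quantise R m y) (hle : ‖x - y‖ ≤ R ^ e) :
    R ^ 12 * ‖x - y‖ ≤ 2 := by
  have hR0 : 0 < R := by linarith
  have haux : ∀ s t : ℝ, |s - t| ≤ ‖x - y‖ →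
      ((⌊R ^ 12 * s⌋ : ℤ) : ZMod m) = ((⌊R ^ 12 * t⌋ : ℤ) : ZMod m) → R ^ 12 * |s - t| ≤ 1 := by
    intro s t hst heq
    have h1 : R ^ 12 * |s - t| = |R ^ 12 * s - R ^ 12 * t| := by
      rw [← mul_sub, abs_mul, abs_of_pos (by positivity : 0 < R ^ 12)]
    have hRe : 1 ≤ R ^ (e + 12) := one_le_pow₀ (by linarith)
    rw [h1]
    refine (abs_sub_lt_one_of_floor_zmod heq ?_).le
    rw [← h1]
    calc R ^ 12 * |s - t| + 1 ≤ R ^ 12 * R ^ e + R ^ (e + 12) := by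
          gcongr; exact hst.trans hle
      _ = 2 * R ^ (e + 12) := by ring
      _ ≤ R * R ^ (e + 12) := by gcongr; linarith
      _ = R ^ (e + 13) := by ring
      _ ≤ m := hm.le
  have h1 := congrArg Prod.fst hxy
  have h2 := congrArg Prod.snd hxy
  have h3 := haux x.re y.re (by simpa using Complex.abs_re_le_norm (x - y)) h1
  have h4 := haux x.im y.im (by simpa using Complex.abs_im_le_norm (x - y)) h2
  have h5 := Complex.norm_le_abs_re_add_abs_im (x - y)
  rw [Complex.sub_re, Complex.sub_im] at h5
  calc R ^ 12 * ‖x - y‖ ≤ R ^ 12 * (|x.re - y.re| + |x.im - y.im|) := by gcongr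
    _ ≤ 2 := by linarith

/-- Two small received combinations of two symbols, over a well-conditioned matrix, force both
symbols to be small. -/
theorem symbols_small {M : ℕ} {R : ℝ} (hR : 100 ≤ R) {h k u v : Vec M} {x y : ℂ}
    (hh : ‖h‖ ≤ R) (hk : ‖k‖ ≤ R) (hu : ‖u‖ ≤ R) (hv : ‖v‖ ≤ R ^ 4)
    (hdet : 1 ≤ R * ‖beamDet h k v u‖) (h1 : R ^ 12 * ‖dotT h (x • v + y • u)‖ ≤ 3 * R)
    (h2 : R ^ 12 * ‖dotT k (x • v + y • u)‖ ≤ 3) : ‖x‖ < 1 ∧ ‖y‖ < 1 := by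
  have hR0 : 0 < R := by linarith
  set p := x • v + y • u with hp
  -- Cramer's rule for the two symbols from the two received combinations.
  have hx : x * beamDet h k v u = dotT k u * dotT h p - dotT h u * dotT k p := by
    simp only [hp, beamDet, dotT_add, dotT_smul]; ring
  have hy : y * beamDet h k v u = dotT h v * dotT k p - dotT k v * dotT h p := by
    simp only [hp, beamDet, dotT_add, dotT_smul]; ring
  have hle : ∀ {g w : Vec M}, ‖g‖ ≤ R → ‖w‖ ≤ R ^ 4 → ‖dotT g w‖ ≤ R ^ 5 := by
    intro g w hg hw
    calc ‖dotT g w‖ ≤ ‖g‖ * ‖w‖ := norm_dotT_le _ _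
      _ ≤ R * R ^ 4 := by gcongr
      _ = R ^ 5 := by ring
  have hu4 : ‖u‖ ≤ R ^ 4 := hu.trans (by
    calc R = R ^ 1 := (pow_one R).symm
      _ ≤ R ^ 4 := pow_le_pow_right₀ (by linarith) (by norm_num))
  have key : ∀ z c c' : ℂ, ‖c‖ ≤ R ^ 5 → ‖c'‖ ≤ R ^ 5 →
      ‖z * beamDet h k v u‖ ≤ ‖c‖ * ‖dotT h p‖ + ‖c'‖ * ‖dotT k p‖ → ‖z‖ < 1 := by
    intro z c c' hc hc' hz
    rw [norm_mul] at hz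
    have e1 : ‖z‖ ≤ R * (‖z‖ * ‖beamDet h k v u‖) := by
      have := mul_le_mul_of_nonneg_left hdet (norm_nonneg z)
      linarith
    have e2 : R * (‖z‖ * ‖beamDet h k v u‖) ≤ R * (R ^ 5 * ‖dotT h p‖ + R ^ 5 * ‖dotT k p‖) := by
      refine mul_le_mul_of_nonneg_left (hz.trans ?_) hR0.le
      gcongr
    have e3 : R ^ 6 * ‖z‖ ≤ R ^ 12 * ‖dotT h p‖ + R ^ 12 * ‖dotT k p‖ := by
      calc R ^ 6 * ‖z‖ ≤ R ^ 6 * (R * (R ^ 5 * ‖dotT h p‖ + R ^ 5 * ‖dotT k p‖)) := by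
            gcongr; exact e1.trans e2
        _ = _ := by ring
    have e4 : R ^ 6 * ‖z‖ ≤ 6 * R := by linarith
    by_contra hcon
    push Not at hcon
    have e5 : R ^ 6 ≤ R ^ 6 * ‖z‖ := le_mul_of_one_le_right (by positivity) hcon
    have e6 : R * R ≤ R ^ 6 := by
      calc R * R = R ^ 2 := (sq R).symm
        _ ≤ R ^ 6 := pow_le_pow_right₀ (by linarith) (by norm_num)
    nlinarith
  constructor
  · refine key x (dotT k u) (dotT h u) (hle hk hu4) (hle hh hu4) ?_
    rw [hx]
    refine (norm_sub_le _ _).trans ?_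
    rw [norm_mul, norm_mul]
  · refine key y (dotT k v) (dotT h v) (hle hk hv) (hle hh hv) ?_
    rw [hy]
    refine (norm_sub_le _ _).trans ?_
    rw [norm_mul, norm_mul, add_comm]

/-! ### Complex symbols -/

/-- The Gaussian integer of a pair of digits. -/
def gauss {m : ℕ} (x : Fin m × Fin m) : ℂ := ((x.1 : ℕ) : ℂ) + ((x.2 : ℕ) : ℂ) * Complex.I

theorem gauss_re {m : ℕ} (x : Fin m × Fin m) : (gauss x).re = ((x.1 : ℕ) : ℝ) := by simp [gauss]

theorem gauss_im {m : ℕ} (x : Fin m × Fin m) : (gauss x).im = ((x.2 : ℕ) : ℝ) := by simp [gauss]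

theorem norm_gauss_le {m : ℕ} (x : Fin m × Fin m) : ‖gauss x‖ ≤ 2 * m := by
  refine (Complex.norm_le_abs_re_add_abs_im _).trans ?_
  rw [gauss_re, gauss_im, abs_of_nonneg (by positivity), abs_of_nonneg (by positivity)]
  have h1 : ((x.1 : ℕ) : ℝ) ≤ m := by exact_mod_cast x.1.2.le
  have h2 : ((x.2 : ℕ) : ℝ) ≤ m := by exact_mod_cast x.2.2.le
  linarith

theorem norm_gauss_sub_le {m : ℕ} (x y : Fin m × Fin m) : ‖gauss x - gauss y‖ ≤ 2 * m := by
  refine (Complex.norm_le_abs_re_add_abs_im _).trans ?_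
  rw [Complex.sub_re, Complex.sub_im, gauss_re, gauss_im, gauss_re, gauss_im]
  have haux : ∀ a b : Fin m, |((a : ℕ) : ℝ) - ((b : ℕ) : ℝ)| ≤ m := by
    intro a b
    have h1 : ((a : ℕ) : ℝ) ≤ m := by exact_mod_cast a.2.le
    have h2 : ((b : ℕ) : ℝ) ≤ m := by exact_mod_cast b.2.le
    have h3 : (0 : ℝ) ≤ ((a : ℕ) : ℝ) := by positivity
    have h4 : (0 : ℝ) ≤ ((b : ℕ) : ℝ) := by positivity
    rw [abs_le]; constructor <;> linarith
  linarith [haux x.1 y.1, haux x.2 y.2]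

theorem eq_of_norm_gauss_sub_lt_one {m : ℕ} {x y : Fin m × Fin m}
    (h : ‖gauss x - gauss y‖ < 1) : x = y := by
  have haux : ∀ a b : Fin m, |((a : ℕ) : ℝ) - ((b : ℕ) : ℝ)| < 1 → a = b := by
    intro a b hab
    have h1 : |((a : ℕ) : ℤ) - ((b : ℕ) : ℤ)| < 1 := by exact_mod_cast hab
    have h2 := Int.abs_lt_one_iff.1 h1
    exact Fin.ext (by omega)
  have h1 := lt_of_le_of_lt (Complex.abs_re_le_norm (gauss x - gauss y)) h
  have h2 := lt_of_le_of_lt (Complex.abs_im_le_norm (gauss x - gauss y)) h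
  rw [Complex.sub_re, gauss_re, gauss_re] at h1
  rw [Complex.sub_im, gauss_im, gauss_im] at h2
  exact Prod.ext (haux _ _ h1) (haux _ _ h2)

/-- The superposition of the symbols `x l` on the amplitude levels `l`. -/
def levels {q : ℕ} (R : ℝ) (L : ℕ) (x : ℕ → Fin q × Fin q) : ℂ :=
  ∑ l ∈ Finset.range L, gauss (x l) * ((R ^ l : ℝ) : ℂ)

theorem norm_levels_le {q : ℕ} {R : ℝ} (hR : 2 ≤ R) (hq : 4 * (q : ℝ) ≤ R) (L : ℕ)
    (x : ℕ → Fin q × Fin q) : ‖levels R L x‖ ≤ R ^ L := by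
  have h1 : ‖levels R L x‖ ≤ ∑ l ∈ Finset.range L, 2 * (R / 4 * R ^ l) := by
    refine (norm_sum_le _ _).trans (Finset.sum_le_sum fun l _ => ?_)
    rw [norm_mul, Complex.norm_real, Real.norm_of_nonneg (by positivity), ← mul_assoc]
    refine mul_le_mul_of_nonneg_right ((norm_gauss_le _).trans ?_) (by positivity)
    linarith
  rw [← Finset.mul_sum] at h1
  linarith [sum_quarter_mul_pow_le hR L]

theorem levels_eq_of_norm_sub_lt {q : ℕ} {R : ℝ} (hR : 2 ≤ R) (hq : 4 * (q : ℝ) ≤ R) {L k : ℕ}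
    {x y : ℕ → Fin q × Fin q} (hlt : ‖levels R L x - levels R L y‖ < R ^ k / 2) :
    ∀ l, k ≤ l → l < L → x l = y l := by
  have h1 := lt_of_le_of_lt (Complex.abs_re_le_norm _) hlt
  have h2 := lt_of_le_of_lt (Complex.abs_im_le_norm _) hlt
  have e1 : (levels R L x - levels R L y).re =
      ∑ l ∈ Finset.range L, ((((x l).1 : ℕ) : ℝ) - (((y l).1 : ℕ) : ℝ)) * R ^ l := by
    simp only [levels, Complex.sub_re, Complex.re_sum, Complex.re_mul_ofReal, gauss_re, sub_mul,
      Finset.sum_sub_distrib]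
  have e2 : (levels R L x - levels R L y).im =
      ∑ l ∈ Finset.range L, ((((x l).2 : ℕ) : ℝ) - (((y l).2 : ℕ) : ℝ)) * R ^ l := by
    simp only [levels, Complex.sub_im, Complex.im_sum, Complex.im_mul_ofReal, gauss_im, sub_mul,
      Finset.sum_sub_distrib]
  rw [e1] at h1
  rw [e2] at h2
  intro l hk hl
  exact Prod.ext
    (Fin.ext (digits_eq_of_abs_sum_lt hR hq (fun l => (x l).1.2) (fun l => (y l).1.2) L h1 l hk hl))
    (Fin.ext (digits_eq_of_abs_sum_lt hR hq (fun l => (x l).2.2) (fun l => (y l).2.2) L h2 l hk hl))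

/-! ### The block scheme -/

/-- The parameters of the block scheme. Layer `r` holds the private symbols of user `r`; they disturb
user `1 - r`. In slot `j` of each block, this layer has two symbols, of `D r j` and of
`D r j - a r j` digits per real dimension. The estimate of the channel of slot `t` that serves to
reconstruct the disturbance is that of the channel of slot `sig t` available at `del t`. The common
symbol on level `l` in slot `j` of a block is the one with number `rep (j, l)`. -/
structure Layout (M : ℕ) where
  Tc : ℕ
  N : ℕ
  K : ℕ
  q : ℕ
  R : ℝ
  D : Fin 2 → ℕ → ℕ
  a : Fin 2 → ℕ → ℕ
  f : Fin 2 → ℕ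
  u : Vec M
  b : Vec M
  sig : ℕ → ℕ
  del : ℕ → ℕ
  rep : ℕ × ℕ → Fin K
  emb : ((∀ (r : Fin 2) (j : Fin Tc), ZMod (q ^ (D r j - a r j + 18)) ×
    ZMod (q ^ (D r j - a r j + 18))) × (∀ r : Fin 2, Fin (q ^ f r))) ↪ (Fin K → Fin q × Fin q)

namespace Layout

variable {M : ℕ} (S : Layout M)

/-- The requirements on the parameters. -/
structure Valid : Prop where
  Tc_pos : 0 < S.Tc
  R_ge : 100 ≤ S.R
  q_le : 4 * (S.q : ℝ) ≤ S.R
  pow_lt : ∀ k ≤ S.N, S.R ^ (k + 17) < (S.q : ℝ) ^ (k + 18)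
  a_le : ∀ r j, S.a r j ≤ S.D r j
  D_le : ∀ r j, S.D r j + 20 ≤ S.N
  norm_u : ‖S.u‖ ≤ S.R
  norm_b : ‖S.b‖ ≤ S.R
  rep_surj : ∀ i k, ∃ j, j < S.Tc ∧ ∃ l, S.D i j + 21 ≤ l ∧ l < S.N - 2 ∧ S.rep (j, l) = k

/-- The message that user `r` gets in one block: the private symbols of the slots, and fresh digits
for the common symbols. -/
abbrev Block (r : Fin 2) : Type :=
  ((j : Fin S.Tc) → (Fin (S.q ^ S.D r j) × Fin (S.q ^ S.D r j)) ×
    (Fin (S.q ^ (S.D r j - S.a r j)) × Fin (S.q ^ (S.D r j - S.a r j)))) × Fin (S.q ^ S.f r)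

/-- The beam of the first private symbol of layer `r`. -/
def beam (r : Fin 2) (t j : ℕ) (E : ℕ → ℕ → Fin 2 → Vec M) : Vec M :=
  if S.a r j = 0 then S.b else zeroForce S.b (E t t (1 - r))

/-- The private signal of layer `r` in slot `j` of block `s`. -/
def priv (r : Fin 2) (s : ℕ) (m : S.Block r) (j : Fin S.Tc) (E : ℕ → ℕ → Fin 2 → Vec M) : Vec M :=
  gauss (m.1 j).1 • S.beam r (s * S.Tc + j) j E + gauss (m.1 j).2 • S.u

/-- The common information about block `s`: the quantised disturbances and the fresh digits. -/
def pay (s : ℕ) (m : ∀ r, S.Block r) (E : ℕ → ℕ → Fin 2 → Vec M) :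
    (∀ (r : Fin 2) (j : Fin S.Tc), ZMod (S.q ^ (S.D r j - S.a r j + 18)) ×
      ZMod (S.q ^ (S.D r j - S.a r j + 18))) × (∀ r : Fin 2, Fin (S.q ^ S.f r)) :=
  (fun r j => quantise S.R _
    (dotT (E (S.sig (s * S.Tc + j)) (S.del (s * S.Tc + j)) (1 - r)) (S.priv r s (m r) j E)),
    fun r => (m r).2)

/-- The common signal that conveys the information about block `s`, in slot `j`. -/
def comm (s : ℕ) (m : ∀ r, S.Block r) (j : ℕ) (E : ℕ → ℕ → Fin 2 → Vec M) : ℂ :=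
  levels S.R (S.N - 2) (fun l => S.emb (S.pay s m E) (S.rep (j, l)))

variable (L lag : ℕ)

/-- The common signal in slot `j` of block `s`. It is about block `s - lag`. -/
def commPart (w : ∀ r, Fin L → S.Block r) (s j : ℕ) (E : ℕ → ℕ → Fin 2 → Vec M) : ℂ :=
  if hs : lag ≤ s ∧ s - lag < L then S.comm (s - lag) (fun r => w r ⟨s - lag, hs.2⟩) j E else 0

/-- The private signal of layer `r` in slot `j` of block `s`; only the first `L` blocks have one. -/
def privPart (w : ∀ r, Fin L → S.Block r) (r : Fin 2) (s : ℕ) (j : Fin S.Tc)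
    (E : ℕ → ℕ → Fin 2 → Vec M) : Vec M :=
  if hs : s < L then S.priv r s (w r ⟨s, hs⟩) j E else 0

/-- The transmitted signal in slot `j` of block `s`. -/
def signal (w : ∀ r, Fin L → S.Block r) (s : ℕ) (j : Fin S.Tc) (E : ℕ → ℕ → Fin 2 → Vec M) :
    Vec M :=
  S.commPart L lag w s j E • S.u + ((S.R ^ 12 : ℝ) : ℂ) • ∑ r, S.privPart L w r s j E

/-- A slot, number `j` of its block and `t` of all, in which the channels `H` are neither too strong
nor ill-conditioned, and the estimates as good as their exponents promise. -/
structure GoodSlot (H : Fin 2 → Vec M) (E : ℕ → ℕ → Fin 2 → Vec M) (t j : ℕ) : Prop where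
  norm_le : ∀ i, ‖H i‖ ≤ S.R
  current : ∀ r, S.a r j = 0 ∨ ‖H (1 - r) - E t t (1 - r)‖ * S.R ^ (S.a r j + 20) ≤ S.R
  delayed : ∀ r, S.D r j = 0 ∨
    ‖H (1 - r) - E (S.sig t) (S.del t) (1 - r)‖ * S.R ^ (S.D r j + 20) ≤ S.R
  gain : ∀ i, 1 ≤ S.R * ‖dotT (H i) S.u‖
  det : ∀ r, 2 ≤ S.R * ‖beamDet (H r) (H (1 - r)) S.b S.u‖
  det_zf : ∀ r, 2 ≤ S.R * ‖beamDet (H r) (H (1 - r)) (zeroForce S.b (H (1 - r))) S.u‖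

variable {S} {L lag}

theorem Valid.q_pow_le (hS : S.Valid) (k : ℕ) : ((S.q ^ k : ℕ) : ℝ) ≤ S.R ^ k := by
  push_cast
  refine pow_le_pow_left₀ (by positivity) ?_ k
  have := hS.q_le
  have : (0 : ℝ) ≤ S.q := by positivity
  linarith

/-! ### A single slot: disturbances and private symbols. -/

section Slot

variable {H : Fin 2 → Vec M} {E : ℕ → ℕ → Fin 2 → Vec M} {s : ℕ} {j : Fin S.Tc}

theorem GoodSlot.beam (hS : S.Valid) {t : ℕ} {j : ℕ} (hG : S.GoodSlot H E t j) (r : Fin 2) :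
    ‖S.beam r t j E‖ ≤ S.R ^ 4 ∧ ‖dotT (H (1 - r)) (S.beam r t j E)‖ * S.R ^ S.a r j ≤ S.R ^ 2 ∧
      1 ≤ S.R * ‖beamDet (H r) (H (1 - r)) (S.beam r t j E) S.u‖ :=
  beam_bounds hS.R_ge (hG.norm_le r) (hG.norm_le (1 - r)) hS.norm_u hS.norm_b (hG.current r)
    (hG.det r) (hG.det_zf r) rfl

theorem priv_sub_eq (r : Fin 2) (m m' : S.Block r) :
    S.priv r s m j E - S.priv r s m' j E =
      (gauss (m.1 j).1 - gauss (m'.1 j).1) • S.beam r (s * S.Tc + j) j E +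
        (gauss (m.1 j).2 - gauss (m'.1 j).2) • S.u := by
  simp only [priv, sub_smul]; abel

theorem norm_priv_le (hS : S.Valid) (hG : S.GoodSlot H E (s * S.Tc + j) j) (r : Fin 2)
    (m : S.Block r) : ‖S.priv r s m j E‖ ≤ S.R ^ (S.D r j + 5) := by
  have hb := hG.beam hS r
  refine (beam_sum_bounds hS.R_ge (hS.a_le r j) (hG.norm_le (1 - r)) hS.norm_u hb.1 hb.2.1
    ?_ ?_).1
  · exact (norm_gauss_le _).trans (by gcongr; exact hS.q_pow_le _)
  · exact (norm_gauss_le _).trans (by gcongr; exact hS.q_pow_le _)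

theorem priv_sub_bounds (hS : S.Valid) (hG : S.GoodSlot H E (s * S.Tc + j) j) (r : Fin 2)
    (m m' : S.Block r) :
    ‖S.priv r s m j E - S.priv r s m' j E‖ ≤ S.R ^ (S.D r j + 5) ∧
      ‖dotT (H (1 - r)) (S.priv r s m j E - S.priv r s m' j E)‖ ≤
        S.R ^ (S.D r j - S.a r j + 3) := by
  have hb := hG.beam hS r
  rw [priv_sub_eq]
  refine beam_sum_bounds hS.R_ge (hS.a_le r j) (hG.norm_le (1 - r)) hS.norm_u hb.1 hb.2.1 ?_ ?_
  · exact (norm_gauss_sub_le _ _).trans (by gcongr; exact hS.q_pow_le _)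
  · exact (norm_gauss_sub_le _ _).trans (by gcongr; exact hS.q_pow_le _)

/-- Needed because `GoodSlot` promises nothing about the delayed estimate when `D r j = 0`; the
symbols then carry no information. -/
theorem priv_eq_of_D_eq_zero (r : Fin 2) (m m' : S.Block r) (hD : S.D r j = 0) :
    S.priv r s m j E = S.priv r s m' j E := by
  have hsub : ∀ k : ℕ, k = 0 → ∀ x y : Fin (S.q ^ k) × Fin (S.q ^ k), x = y := by
    rintro k rfl x y
    have : Subsingleton (Fin (S.q ^ 0)) := by rw [pow_zero]; infer_instance
    exact Subsingleton.elim _ _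
  have h1 := hsub _ hD (m.1 j).1 (m'.1 j).1
  have h2 := hsub _ (by omega : S.D r j - S.a r j = 0) (m.1 j).2 (m'.1 j).2
  simp only [priv, h1, h2]

/-- Equal payloads fix the disturbance seen through the delayed estimate `g` up to two quantiser
steps, and replacing `g` by the true channel costs at most one more. -/
theorem disturbance_small (hS : S.Valid) (hG : S.GoodSlot H E (s * S.Tc + j) j)
    {m m' : ∀ r, S.Block r} (hpay : S.pay s m E = S.pay s m' E) (r : Fin 2) :
    S.R ^ 12 * ‖dotT (H (1 - r)) (S.priv r s (m r) j E - S.priv r s (m' r) j E)‖ ≤ 3 := by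
  have hR := hS.R_ge
  have hR0 : 0 < S.R := by linarith
  obtain ⟨hp, hk⟩ := priv_sub_bounds hS hG r (m r) (m' r)
  set g := E (S.sig (s * S.Tc + j)) (S.del (s * S.Tc + j)) (1 - r) with hg
  set p := S.priv r s (m r) j E - S.priv r s (m' r) j E with hpdef
  have hres : S.R ^ 12 * ‖dotT (H (1 - r) - g) p‖ ≤ 1 := by
    refine delayed_residual_le hR ?_ hp
    rcases hG.delayed r with h | h
    · left
      rw [hpdef, priv_eq_of_D_eq_zero r (m r) (m' r) h, sub_self]
    · exact Or.inr h
  have hsplit : dotT (H (1 - r)) p = dotT g p + dotT (H (1 - r) - g) p := by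
    rw [sub_dotT]; ring
  have hgp : ‖dotT g p‖ ≤ S.R ^ (S.D r j - S.a r j + 4) := by
    have h1 : dotT g p = dotT (H (1 - r)) p - dotT (H (1 - r) - g) p := by rw [hsplit]; ring
    have h2 : ‖dotT (H (1 - r) - g) p‖ ≤ 1 := by
      refine le_trans ?_ hres
      exact le_mul_of_one_le_left (norm_nonneg _) (one_le_pow₀ (by linarith))
    have h3 : 1 ≤ S.R ^ (S.D r j - S.a r j + 3) := one_le_pow₀ (by linarith)
    rw [h1]
    calc ‖dotT (H (1 - r)) p - dotT (H (1 - r) - g) p‖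
        ≤ S.R ^ (S.D r j - S.a r j + 3) + S.R ^ (S.D r j - S.a r j + 3) :=
          (norm_sub_le _ _).trans (add_le_add hk (h2.trans h3))
      _ = 2 * S.R ^ (S.D r j - S.a r j + 3) := by ring
      _ ≤ S.R * S.R ^ (S.D r j - S.a r j + 3) := by gcongr; linarith
      _ = S.R ^ (S.D r j - S.a r j + 4) := by ring
  have hq := congrFun (congrFun (congrArg Prod.fst hpay) r) j
  simp only [pay] at hq
  rw [hpdef, dotT_sub] at hgp
  have hquant := norm_sub_le_of_quantise_eq hR (by
    have h1 := hS.pow_lt (S.D r j - S.a r j) (by have := hS.D_le r j; omega)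
    push_cast
    exact h1) hq hgp
  rw [← dotT_sub, ← hpdef] at hquant
  rw [hsplit]
  calc S.R ^ 12 * ‖dotT g p + dotT (H (1 - r) - g) p‖
      ≤ S.R ^ 12 * (‖dotT g p‖ + ‖dotT (H (1 - r) - g) p‖) := by
        gcongr; exact norm_add_le _ _
    _ ≤ 3 := by linarith

/-- The user's own reception is one equation, and the disturbance it caused at the other user, known
from the payload, is the second. -/
theorem symbols_eq (hS : S.Valid) (hG : S.GoodSlot H E (s * S.Tc + j) j) (r : Fin 2)
    {m m' : S.Block r}
    (h1 : S.R ^ 12 * ‖dotT (H r) (S.priv r s m j E - S.priv r s m' j E)‖ ≤ 3 * S.R)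
    (h2 : S.R ^ 12 * ‖dotT (H (1 - r)) (S.priv r s m j E - S.priv r s m' j E)‖ ≤ 3) :
    m.1 j = m'.1 j := by
  have hb := hG.beam hS r
  rw [priv_sub_eq] at h1 h2
  obtain ⟨hx, hy⟩ := symbols_small hS.R_ge (hG.norm_le r) (hG.norm_le (1 - r)) hS.norm_u hb.1
    hb.2.2 h1 h2
  exact Prod.ext (eq_of_norm_gauss_sub_lt_one hx) (eq_of_norm_gauss_sub_lt_one hy)

end Slot

/-! ### Backward decoding across blocks, and the power of the signal. -/

section Blocks

variable {H : ℕ → Fin 2 → Vec M} {E : ℕ → ℕ → Fin 2 → Vec M} {w w' : ∀ r, Fin L → S.Block r}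
  {s : ℕ}

theorem privPart_sub_le (hS : S.Valid) (j : Fin S.Tc)
    (hG : S.GoodSlot (H (s * S.Tc + j)) E (s * S.Tc + j) j) (r : Fin 2) :
    ‖S.privPart L w r s j E - S.privPart L w' r s j E‖ ≤ S.R ^ (S.D r j + 5) := by
  have hR0 : 0 < S.R := by linarith [hS.R_ge]
  unfold privPart
  split_ifs with hs
  · exact (priv_sub_bounds hS hG r _ _).1
  · simp only [sub_self, norm_zero]; positivity

theorem privPart_disturbance (hS : S.Valid) (j : Fin S.Tc)
    (hG : S.GoodSlot (H (s * S.Tc + j)) E (s * S.Tc + j) j)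
    (hpay : ∀ hs : s < L,
      S.pay s (fun r => w r ⟨s, hs⟩) E = S.pay s (fun r => w' r ⟨s, hs⟩) E) (r : Fin 2) :
    S.R ^ 12 * ‖dotT (H (s * S.Tc + j) (1 - r))
      (S.privPart L w r s j E - S.privPart L w' r s j E)‖ ≤ 3 := by
  unfold privPart
  split_ifs with hs
  · exact disturbance_small hS hG (hpay hs) r
  · simp [dotT_zero]

/-- After the known disturbance is removed, only the common signal and the own private signal are
left above the noise. -/
theorem residual_le (hS : S.Valid) (i : Fin 2) (j : Fin S.Tc)
    (hG : S.GoodSlot (H (s * S.Tc + j)) E (s * S.Tc + j) j)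
    (hpay : ∀ hs : s < L,
      S.pay s (fun r => w r ⟨s, hs⟩) E = S.pay s (fun r => w' r ⟨s, hs⟩) E)
    (hclose : ‖dotT (H (s * S.Tc + j) i) (S.signal L lag w s j E) -
      dotT (H (s * S.Tc + j) i) (S.signal L lag w' s j E)‖ ≤ 2 * S.R) :
    ‖(S.commPart L lag w s j E - S.commPart L lag w' s j E) * dotT (H (s * S.Tc + j) i) S.u +
      ((S.R ^ 12 : ℝ) : ℂ) * dotT (H (s * S.Tc + j) i)
        (S.privPart L w i s j E - S.privPart L w' i s j E)‖ ≤ 3 * S.R := by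
  have hR := hS.R_ge
  have hdist := privPart_disturbance (w := w) (w' := w') hS j hG hpay (1 - i)
  rw [sub_sub_cancel] at hdist
  set k := H (s * S.Tc + j) i with hk
  set o := ((S.R ^ 12 : ℝ) : ℂ) * dotT k
    (S.privPart L w (1 - i) s j E - S.privPart L w' (1 - i) s j E) with ho
  have hon : ‖o‖ ≤ 3 := by
    rw [ho, norm_mul, Complex.norm_real, Real.norm_of_nonneg (by positivity)]
    exact hdist
  have hsum : ∀ v : ∀ r, Fin L → S.Block r, ∑ r, S.privPart L v r s j E =
      S.privPart L v i s j E + S.privPart L v (1 - i) s j E := by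
    intro v
    rw [Fin.sum_univ_two]
    fin_cases i
    · rfl
    · exact add_comm _ _
  have hdec : (S.commPart L lag w s j E - S.commPart L lag w' s j E) * dotT k S.u +
      ((S.R ^ 12 : ℝ) : ℂ) * dotT k (S.privPart L w i s j E - S.privPart L w' i s j E) =
      (dotT k (S.signal L lag w s j E) - dotT k (S.signal L lag w' s j E)) - o := by
    simp only [signal, hsum, ho, dotT_add, dotT_smul, dotT_sub]
    ring
  rw [hdec]
  refine (norm_sub_le _ _).trans ?_
  linarith

/-- With the disturbance removed, the user's own private signal reaches at most level `D i j + 18`.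
Division by the gain, which is at least `1 / R`, and the margin required for separating digits raise
this to `D i j + 21`, the lowest level in `rep_surj`. -/
theorem pay_eq_of_close (hS : S.Valid) (i : Fin 2)
    (hG : ∀ j : Fin S.Tc, S.GoodSlot (H (s * S.Tc + j)) E (s * S.Tc + j) j)
    (hpay : ∀ hs : s < L,
      S.pay s (fun r => w r ⟨s, hs⟩) E = S.pay s (fun r => w' r ⟨s, hs⟩) E)
    (hclose : ∀ j : Fin S.Tc, ‖dotT (H (s * S.Tc + j) i) (S.signal L lag w s j E) -
      dotT (H (s * S.Tc + j) i) (S.signal L lag w' s j E)‖ ≤ 2 * S.R)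
    (hs : lag ≤ s ∧ s - lag < L) :
    S.pay (s - lag) (fun r => w r ⟨s - lag, hs.2⟩) E =
      S.pay (s - lag) (fun r => w' r ⟨s - lag, hs.2⟩) E := by
  have hR := hS.R_ge
  have hR0 : 0 < S.R := by linarith
  refine S.emb.injective (funext fun k => ?_)
  obtain ⟨j, hj, l, hl1, hl2, rfl⟩ := hS.rep_surj i k
  have hres := residual_le hS i ⟨j, hj⟩ (hG ⟨j, hj⟩) hpay (hclose ⟨j, hj⟩)
  have hpp := privPart_sub_le (w := w) (w' := w') hS ⟨j, hj⟩ (hG ⟨j, hj⟩) i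
  have hgain := (hG ⟨j, hj⟩).gain i
  have hnorm := (hG ⟨j, hj⟩).norm_le i
  simp only at hres hpp hgain hnorm
  set kk := H (s * S.Tc + j) i with hkk
  set Δ := S.commPart L lag w s j E - S.commPart L lag w' s j E with hΔ
  set p := S.privPart L w i s ⟨j, hj⟩ E - S.privPart L w' i s ⟨j, hj⟩ E with hp
  have h1 : ‖((S.R ^ 12 : ℝ) : ℂ) * dotT kk p‖ ≤ S.R ^ (S.D i j + 18) := by
    rw [norm_mul, Complex.norm_real, Real.norm_of_nonneg (by positivity)]
    calc S.R ^ 12 * ‖dotT kk p‖ ≤ S.R ^ 12 * (S.R * S.R ^ (S.D i j + 5)) := by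
          gcongr
          exact (norm_dotT_le _ _).trans (by gcongr)
      _ = S.R ^ (S.D i j + 18) := by ring
  have h2 : ‖Δ * dotT kk S.u‖ ≤ 3 * S.R + S.R ^ (S.D i j + 18) := by
    have h3 : Δ * dotT kk S.u = (Δ * dotT kk S.u + ((S.R ^ 12 : ℝ) : ℂ) * dotT kk p) -
      ((S.R ^ 12 : ℝ) : ℂ) * dotT kk p := by ring
    rw [h3]
    exact (norm_sub_le _ _).trans (add_le_add hres h1)
  have h4 : 3 * S.R ≤ S.R ^ (S.D i j + 18) := by
    calc 3 * S.R ≤ S.R * S.R := by gcongr; linarith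
      _ = S.R ^ 2 := (sq _).symm
      _ ≤ S.R ^ (S.D i j + 18) := pow_le_pow_right₀ (by linarith) (by omega)
  have h5 : ‖Δ‖ < S.R ^ (S.D i j + 21) / 2 := by
    rw [norm_mul] at h2
    have h6 : ‖Δ‖ ≤ S.R * (‖Δ‖ * ‖dotT kk S.u‖) := by
      have := mul_le_mul_of_nonneg_left hgain (norm_nonneg Δ)
      linarith
    have hpos : 0 < S.R ^ (S.D i j + 19) := by positivity
    calc ‖Δ‖ ≤ S.R * (‖Δ‖ * ‖dotT kk S.u‖) := h6
      _ ≤ S.R * (S.R ^ (S.D i j + 18) + S.R ^ (S.D i j + 18)) := by gcongr; linarith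
      _ = 2 * S.R ^ (S.D i j + 19) := by ring
      _ < S.R ^ 2 / 2 * S.R ^ (S.D i j + 19) := by gcongr; nlinarith
      _ = S.R ^ (S.D i j + 21) / 2 := by ring
  rw [hΔ] at h5
  simp only [commPart, dif_pos hs, comm] at h5
  exact levels_eq_of_norm_sub_lt (by linarith) hS.q_le h5 l hl1 hl2

/-- The received signals of user `i` determine its message. -/
theorem message_eq_of_close (hS : S.Valid) (hlag : 0 < lag) (i : Fin 2)
    (hG : ∀ s < L + lag, ∀ j : Fin S.Tc, S.GoodSlot (H (s * S.Tc + j)) E (s * S.Tc + j) j)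
    (hclose : ∀ s < L + lag, ∀ j : Fin S.Tc,
      ‖dotT (H (s * S.Tc + j) i) (S.signal L lag w s j E) -
        dotT (H (s * S.Tc + j) i) (S.signal L lag w' s j E)‖ ≤ 2 * S.R) : w i = w' i := by
  have hR := hS.R_ge
  -- Induction on the distance `n` to the end. Blocks from `L` on have no private signal, so the
  -- last payloads are read without prior knowledge.
  have hpay : ∀ n s, L ≤ s + n → ∀ hs : s < L,
      S.pay s (fun r => w r ⟨s, hs⟩) E = S.pay s (fun r => w' r ⟨s, hs⟩) E := by
    intro n
    induction n with
    | zero => intro s h1 h2; omega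
    | succ n ih =>
      intro s h1 h2
      have key := pay_eq_of_close (lag := lag) hS i (hG (s + lag) (by omega))
        (fun hs => ih (s + lag) (by omega) hs) (hclose (s + lag) (by omega))
        ⟨by omega, by omega⟩
      simpa only [Nat.add_sub_cancel] using key
  have hpay' : ∀ s (hs : s < L),
      S.pay s (fun r => w r ⟨s, hs⟩) E = S.pay s (fun r => w' r ⟨s, hs⟩) E :=
    fun s hs => hpay L s (by omega) hs
  funext ⟨s, hs⟩
  refine Prod.ext (funext fun j => ?_) ?_
  · have hg := hG s (by omega) j
    refine symbols_eq hS hg i ?_ (disturbance_small hS hg (hpay' s hs) i)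
    have hres := residual_le hS i j hg (hpay' s) (hclose s (by omega) j)
    have hc : S.commPart L lag w s j E = S.commPart L lag w' s j E := by
      unfold commPart
      split_ifs with h
      · simp only [comm, hpay' (s - lag) h.2]
      · rfl
    rw [hc, sub_self, zero_mul, zero_add, norm_mul, Complex.norm_real,
      Real.norm_of_nonneg (by positivity)] at hres
    simpa only [privPart, dif_pos hs] using hres
  · exact congrFun (congrArg Prod.snd (hpay' s hs)) i

theorem norm_signal_le (hS : S.Valid) (j : Fin S.Tc)
    (hG : S.GoodSlot (H (s * S.Tc + j)) E (s * S.Tc + j) j) :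
    ‖S.signal L lag w s j E‖ ≤ S.R ^ S.N := by
  have hR := hS.R_ge
  have hR0 : 0 < S.R := by linarith
  have hN : 20 ≤ S.N := by have := hS.D_le 0 0; omega
  have h1 : ‖S.commPart L lag w s j E‖ ≤ S.R ^ (S.N - 2) := by
    unfold commPart
    split_ifs
    · exact norm_levels_le (by linarith) hS.q_le _ _
    · rw [norm_zero]; positivity
  have h2 : ∀ r, S.R ^ 12 * ‖S.privPart L w r s j E‖ ≤ S.R ^ (S.N - 2) * S.R := by
    intro r
    have h3 : ‖S.privPart L w r s j E‖ ≤ S.R ^ (S.D r j + 5) := by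
      unfold privPart
      split_ifs
      · exact norm_priv_le hS hG r _
      · rw [norm_zero]; positivity
    calc S.R ^ 12 * ‖S.privPart L w r s j E‖ ≤ S.R ^ 12 * S.R ^ (S.D r j + 5) := by gcongr
      _ = S.R ^ (S.D r j + 17) := by ring
      _ ≤ S.R ^ (S.N - 2 + 1) :=
        pow_le_pow_right₀ (by linarith) (by have := hS.D_le r j; omega)
      _ = _ := pow_succ _ _
  have h4 : S.R ^ S.N = S.R ^ (S.N - 2) * S.R ^ 2 := by rw [← pow_add]; congr 1; omega
  unfold signal
  refine (norm_add_le _ _).trans ?_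
  rw [norm_smul, norm_smul, Complex.norm_real, Real.norm_of_nonneg (by positivity), h4,
    Fin.sum_univ_two]
  have h5 : S.R ^ 12 * ‖S.privPart L w 0 s j E + S.privPart L w 1 s j E‖ ≤
      S.R ^ (S.N - 2) * S.R + S.R ^ (S.N - 2) * S.R := by
    refine le_trans ?_ (add_le_add (h2 0) (h2 1))
    rw [← mul_add]
    gcongr
    exact norm_add_le _ _
  have h6 : ‖S.commPart L lag w s j E‖ * ‖S.u‖ ≤ S.R ^ (S.N - 2) * S.R :=
    mul_le_mul h1 hS.norm_u (norm_nonneg _) (by positivity)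
  have h7 : 3 * (S.R ^ (S.N - 2) * S.R) ≤ S.R ^ (S.N - 2) * S.R ^ 2 := by
    have : 0 < S.R ^ (S.N - 2) * S.R := by positivity
    nlinarith
  linarith

end Blocks

end Layout

/-! ### The code of the block scheme -/

/-- The estimates exchanged during `n` slots, extended by zero to all slots. -/
def extendEst {M n : ℕ} (e : Fin n → Fin n → Fin 2 → Vec M) : ℕ → ℕ → Fin 2 → Vec M :=
  fun s t v => if hst : s < n ∧ t < n then e ⟨s, hst.1⟩ ⟨t, hst.2⟩ v else 0

theorem measurable_extendEst {M n : ℕ} (s t : ℕ) (v : Fin 2) :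
    Measurable (fun e : Fin n → Fin n → Fin 2 → Vec M => extendEst e s t v) := by
  unfold extendEst
  split_ifs
  · fun_prop
  · exact measurable_const

namespace Layout

variable {M : ℕ} {S : Layout M} {L lag : ℕ}

section Measurability

variable {X : Type*} [MeasurableSpace X] {E : X → ℕ → ℕ → Fin 2 → Vec M}

theorem measurable_priv (hE : ∀ s t v, Measurable fun x => E x s t v) (r : Fin 2) (s : ℕ)
    (m : S.Block r) (j : Fin S.Tc) : Measurable fun x => S.priv r s m j (E x) := by
  have hbeam : Measurable fun x => S.beam r (s * S.Tc + j) j (E x) := by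
    unfold beam
    split_ifs
    · exact measurable_const
    · exact (measurable_zeroForce _).comp (hE _ _ _)
  unfold priv
  exact (hbeam.const_smul (gauss (m.1 j).1)).add measurable_const

theorem measurable_comm (hE : ∀ s t v, Measurable fun x => E x s t v) (s : ℕ)
    (m : ∀ r, S.Block r) (j : ℕ) : Measurable fun x => S.comm s m j (E x) := by
  let _ : ∀ m, MeasurableSpace (ZMod m) := fun _ => ⊤
  have : ∀ m, MeasurableSingletonClass (ZMod m) := fun _ => ⟨fun _ => trivial⟩
  have : ∀ m, Countable (ZMod m) := fun m => by
    cases m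
    · exact inferInstanceAs (Countable ℤ)
    · exact inferInstanceAs (Countable (Fin _))
  have hpay : Measurable fun x => S.pay s m (E x) := by
    unfold pay
    refine Measurable.prodMk ?_ measurable_const
    refine measurable_pi_lambda _ fun r => measurable_pi_lambda _ fun j => ?_
    exact (measurable_quantise _ _).comp (measurable_dotT (hE _ _ _) (measurable_priv hE _ _ _ _))
  unfold comm
  exact Measurable.comp (g := fun p => levels S.R (S.N - 2) (fun l => S.emb p (S.rep (j, l))))
    (measurable_of_countable _) hpay

theorem measurable_signal (hE : ∀ s t v, Measurable fun x => E x s t v)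
    (w : ∀ r, Fin L → S.Block r) (s : ℕ) (j : Fin S.Tc) :
    Measurable fun x => S.signal L lag w s j (E x) := by
  have hc : Measurable fun x => S.commPart L lag w s j (E x) := by
    unfold commPart
    split_ifs
    · exact measurable_comm hE _ _ _
    · exact measurable_const
  have hp : ∀ r, Measurable fun x => S.privPart L w r s j (E x) := by
    intro r
    unfold privPart
    split_ifs
    · exact measurable_priv hE _ _ _ _
    · exact measurable_const
  unfold signal
  exact (hc.smul_const S.u).add
    ((Finset.measurable_sum Finset.univ fun r _ => hp r).const_smul ((S.R ^ 12 : ℝ) : ℂ))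

end Measurability

/-- Causality: the common signal concerns a block `lag` earlier, so all delayed estimates it uses
have arrived, even those for that block's last slot. -/
theorem signal_congr {η : ℕ} (hdel : ∀ t, S.del t ≤ t + η) (hη : S.Tc + η ≤ lag * S.Tc)
    {E E' : ℕ → ℕ → Fin 2 → Vec M} (w : ∀ r, Fin L → S.Block r) (s : ℕ) (j : Fin S.Tc)
    (hE : ∀ x t v, t ≤ s * S.Tc + j → E x t v = E' x t v) :
    S.signal L lag w s j E = S.signal L lag w s j E' := by
  have hpriv : ∀ r s' m (j' : Fin S.Tc), s' * S.Tc + j' ≤ s * S.Tc + j →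
      S.priv r s' m j' E = S.priv r s' m j' E' := by
    intro r s' m j' hle
    simp only [priv, beam, hE _ _ _ hle]
  have hc : S.commPart L lag w s j E = S.commPart L lag w s j E' := by
    unfold commPart
    split_ifs with hs
    · have hle : ∀ j' : Fin S.Tc, (s - lag) * S.Tc + j' + η ≤ s * S.Tc + j := by
        intro j'
        have h1 : (s - lag) * S.Tc + lag * S.Tc = s * S.Tc := by
          rw [← add_mul, Nat.sub_add_cancel hs.1]
        have := j'.2
        omega
      have : S.pay (s - lag) (fun r => w r ⟨s - lag, hs.2⟩) E =
          S.pay (s - lag) (fun r => w r ⟨s - lag, hs.2⟩) E' := by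
        simp only [pay]
        refine Prod.ext (funext fun r => funext fun j' => ?_) rfl
        simp only
        rw [hpriv r _ _ j' (by have := hle j'; omega), hE _ _ _ ((hdel _).trans (hle j'))]
      simp only [comm, this]
    · rfl
  have hp : ∀ r, S.privPart L w r s j E = S.privPart L w r s j E' := by
    intro r
    unfold privPart
    split_ifs
    · exact hpriv _ _ _ _ le_rfl
    · rfl
  simp only [signal, hc, hp]

theorem Valid.q_pos (hS : S.Valid) : 0 < S.q := by
  have h1 := hS.pow_lt 0 (Nat.zero_le _)
  have hR := hS.R_ge
  by_contra hq
  have : S.q = 0 := by omega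
  rw [this] at h1
  have : 0 < S.R ^ (0 + 17) := by positivity
  simp only [Nat.cast_zero, ne_eq, Nat.add_eq_zero_iff, OfNat.ofNat_ne_zero, and_false,
    not_false_eq_true, zero_pow] at h1
  linarith

theorem card_message (r : Fin 2) : Fintype.card (Fin L → S.Block r) =
    S.q ^ (L * (∑ j ∈ Finset.range S.Tc, 2 * (S.D r j + (S.D r j - S.a r j)) + S.f r)) := by
  rw [Fintype.card_fun, Fintype.card_fin, Fintype.card_prod, Fintype.card_pi, Fintype.card_fin,
    mul_comm L, pow_mul, pow_add, Finset.sum_range, ← Finset.prod_pow_eq_pow_sum]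
  congr 2
  refine Finset.prod_congr rfl fun j _ => ?_
  simp only [Fintype.card_prod, Fintype.card_fin]
  ring

theorem exists_code {Ω : Type*} [MeasurableSpace Ω] (μ : Measure Ω) [IsProbabilityMeasure μ]
    (hS : S.Valid) (hlag : 0 < lag) {η n : ℕ} (hn : (L + lag) * S.Tc ≤ n)
    (hdel : ∀ t, S.del t ≤ t + η) (hη : S.Tc + η ≤ lag * S.Tc) (h : Channel Ω M)
    (est : Feedback Ω M) {P : ℝ} (hP : (S.R ^ S.N) ^ 2 = P) (G : Set Ω)
    (hG : ∀ ω ∈ G, ∀ t < (L + lag) * S.Tc, S.GoodSlot (fun i => h t i ω)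
      (extendEst (Code.estimates (n := n) est P ω)) t (t % S.Tc)) :
    ∃ C : Code M n, (∀ r, C.size r = S.q ^ (L * (∑ j ∈ Finset.range S.Tc,
        2 * (S.D r j + (S.D r j - S.a r j)) + S.f r))) ∧ C.PowerConstraint μ est P ∧
      C.errorProb μ h est P ≤ μ Gᶜ +
        (Measure.pi (fun _ : Fin 2 × Fin n => complexGaussian 1)) {z | ∃ p, S.R < ‖z p‖} := by
  have hTc := hS.Tc_pos
  have hR0 : 0 < S.R := by linarith [hS.R_ge]
  have : NeZero S.q := ⟨hS.q_pos.ne'⟩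
  let x : ℕ → (∀ r, Fin L → S.Block r) → (Fin n → Fin n → Fin 2 → Vec M) → Vec M :=
    fun t w e => S.signal L lag w (t / S.Tc) ⟨t % S.Tc, Nat.mod_lt _ hTc⟩ (extendEst e)
  -- Bad estimates could violate the power limit; nothing is then sent. The test looks only at the
  -- signal itself, which preserves causality, and `norm_signal_le` makes it void in good slots.
  let X : Fin n → (∀ r, Fin L → S.Block r) → (Fin n → Fin n → Fin 2 → Vec M) → Vec M :=
    fun t w e => if ‖x t w e‖ ≤ S.R ^ S.N then x t w e else 0
  have hx : ∀ t w, Measurable (x t w) := fun t w => measurable_signal measurable_extendEst w _ _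
  have hmod : ∀ s (j : Fin S.Tc), (s * S.Tc + j) % S.Tc = j := fun s j => by
    rw [Nat.mul_add_mod_self_right, Nat.mod_eq_of_lt j.2]
  have hdiv : ∀ t, t / S.Tc * S.Tc + t % S.Tc = t := fun t => Nat.div_add_mod' t S.Tc
  obtain ⟨C, h1, h2, h3⟩ := exists_code_of_separated μ (fun r => Fin L → S.Block r) X
    (fun t w => Measurable.ite (measurableSet_le (hx t w).norm measurable_const) (hx t w)
      measurable_const)
    (by
      intro t w e e' he
      have : x t w e = x t w e' := by
        refine signal_congr hdel hη w _ _ fun a b v hb => ?_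
        simp only [hdiv] at hb
        unfold extendEst
        split_ifs with hab
        · exact he _ _ _ hb
        · rfl
      simp only [X, this])
    h est P S.R
    (by
      intro e t w
      rw [← hP]
      simp only [X]
      split_ifs with hle
      · exact pow_le_pow_left₀ (norm_nonneg _) hle 2
      · rw [norm_zero, zero_pow two_ne_zero]; exact sq_nonneg _)
    G
    (by
      intro ω hω i w w' hclose
      set E := extendEst (Code.estimates (n := n) est P ω) with hE
      have hslot : ∀ s < L + lag, ∀ j : Fin S.Tc, s * S.Tc + j < (L + lag) * S.Tc := by
        intro s hs j
        calc s * S.Tc + j < s * S.Tc + S.Tc := by have := j.2; omega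
          _ = (s + 1) * S.Tc := by ring
          _ ≤ (L + lag) * S.Tc := Nat.mul_le_mul_right _ hs
      have hgood : ∀ s < L + lag, ∀ j : Fin S.Tc,
          S.GoodSlot (fun i => h (s * S.Tc + j) i ω) E (s * S.Tc + j) j := by
        intro s hs j
        have h1 := hG ω hω _ (hslot s hs j)
        rwa [hmod] at h1
      refine message_eq_of_close (H := fun t i => h t i ω) (E := E) hS hlag i hgood ?_
      intro s hs j
      have hlt := lt_of_lt_of_le (hslot s hs j) hn
      have hX : ∀ v, X ⟨s * S.Tc + j, hlt⟩ v (Code.estimates est P ω) =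
          S.signal L lag v s j E := by
        intro v
        have hxe : x (s * S.Tc + j) v (Code.estimates est P ω) = S.signal L lag v s j E := by
          have h1 : (s * S.Tc + j) / S.Tc = s := by
            rw [mul_comm, Nat.mul_add_div hTc, Nat.div_eq_of_lt j.2, add_zero]
          have h2 : (⟨(s * S.Tc + j) % S.Tc, Nat.mod_lt _ hTc⟩ : Fin S.Tc) = j :=
            Fin.ext (hmod s j)
          simp only [x, h1, h2, hE]
        have hle := norm_signal_le (H := fun t i => h t i ω) (L := L) (lag := lag) (w := v) hS j
          (hgood s hs j)
        simp only [X, hxe, if_pos hle]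
      have := hclose ⟨s * S.Tc + j, hlt⟩
      rwa [hX, hX] at this)
  exact ⟨C, fun r => (h1 r).trans (card_message r), h2, h3⟩

end Layout

/-- The code with a single message and no transmission. -/
theorem exists_silent_code {Ω : Type*} [MeasurableSpace Ω] (μ : Measure Ω)
    [IsProbabilityMeasure μ] (M n : ℕ) (h : Channel Ω M) (est : Feedback Ω M) {P : ℝ}
    (hP : 0 ≤ P) : ∃ C : Code M n, C.PowerConstraint μ est P := by
  obtain ⟨C, -, hC, -⟩ := exists_code_of_separated μ (fun _ : Fin 2 => Unit)
    (fun (_ : Fin n) _ _ => (0 : Vec M)) (fun _ _ => measurable_const) (fun _ _ _ _ _ => rfl)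
    h est P 0 (fun _ _ _ => by simpa using hP) Set.univ (fun _ _ _ _ _ _ => rfl)
  exact ⟨C, hC⟩

/-! ### Events of high probability -/

/-- The event `A P` has probability tending to one as `P → ∞`. -/
def WithHighProb {Ω : Type*} [MeasurableSpace Ω] (μ : Measure Ω) (A : ℝ → Ω → Prop) : Prop :=
  Tendsto (fun P => μ {ω | ¬ A P ω}) atTop (𝓝 0)

namespace WithHighProb

variable {Ω : Type*} [MeasurableSpace Ω] {μ : Measure Ω}

theorem and {A B : ℝ → Ω → Prop} (hA : WithHighProb μ A) (hB : WithHighProb μ B) :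
    WithHighProb μ (fun P ω => A P ω ∧ B P ω) := by
  have h := Tendsto.add hA hB
  rw [add_zero] at h
  refine tendsto_of_tendsto_of_tendsto_of_le_of_le tendsto_const_nhds h (fun _ => zero_le)
    fun P => ?_
  refine (measure_mono ?_).trans (measure_union_le _ _)
  intro ω hω
  exact not_and_or.1 hω

theorem forall_fintype {ι : Type*} [Fintype ι] {A : ι → ℝ → Ω → Prop}
    (hA : ∀ k, WithHighProb μ (A k)) : WithHighProb μ (fun P ω => ∀ k, A k P ω) := by
  have h := tendsto_finsetSum Finset.univ fun k _ => hA k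
  rw [Finset.sum_const_zero] at h
  refine tendsto_of_tendsto_of_tendsto_of_le_of_le tendsto_const_nhds h (fun _ => zero_le)
    fun P => ?_
  refine (measure_mono ?_).trans (measure_iUnion_fintype_le μ fun k => {ω | ¬ A k P ω})
  intro ω hω
  obtain ⟨k, hk⟩ := not_forall.1 hω
  exact Set.mem_iUnion.2 ⟨k, hk⟩

theorem or_of_not {p : Prop} {A : ℝ → Ω → Prop} (hA : ¬ p → WithHighProb μ A) :
    WithHighProb μ (fun P ω => p ∨ A P ω) := by
  by_cases hp : p
  · simp [WithHighProb, hp]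
  · simpa [WithHighProb, hp] using hA hp

end WithHighProb

/-! ### Growth of the digit alphabet, and existence of the symbol maps. -/

theorem tendsto_log_floor_unit {N : ℕ} (hN : 0 < N) :
    Tendsto (fun P => Real.log (⌊1 / 4 * unit N P⌋₊ : ℝ) / Real.log P) atTop
      (𝓝 (1 / (2 * (N : ℝ)))) := by
  have hU := tendsto_unit hN
  have h1 : Tendsto (fun P => Real.log ((⌊1 / 4 * unit N P⌋₊ : ℝ) / unit N P)) atTop
      (𝓝 (Real.log (1 / 4))) :=
    ((tendsto_nat_floor_mul_div_atTop (R := ℝ) (by norm_num : (0 : ℝ) ≤ 1 / 4)).comp hU).log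
      (by norm_num)
  have h2 : Tendsto (fun P => Real.log ((⌊1 / 4 * unit N P⌋₊ : ℝ) / unit N P) / Real.log P +
      1 / (2 * (N : ℝ))) atTop (𝓝 (0 + 1 / (2 * (N : ℝ)))) :=
    (h1.div_atTop Real.tendsto_log_atTop).add_const _
  rw [zero_add] at h2
  refine h2.congr' ?_
  filter_upwards [hU.eventually_ge_atTop 4, eventually_gt_atTop 1] with P h4 hP
  have hfl : (0 : ℝ) < ⌊1 / 4 * unit N P⌋₊ := by
    have : 0 < ⌊1 / 4 * unit N P⌋₊ := Nat.floor_pos.2 (by linarith)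
    exact_mod_cast this
  have hu0 : 0 < unit N P := by linarith
  have hlog := Real.log_pos hP
  rw [Real.log_div hfl.ne' hu0.ne', sub_div]
  have : Real.log (unit N P) = 1 / (2 * (N : ℝ)) * Real.log P := by
    rw [unit, Real.log_rpow (by linarith)]
  rw [this, mul_div_cancel_right₀ _ hlog.ne']
  ring

/-- As `⌊R / 4⌋₊ ≥ R / 8` for large `R`, one extra digit outweighs the factor `8 ^ (k + 18)` lost to
the smaller base. -/
theorem eventually_pow_lt_floor_pow (N : ℕ) : ∀ᶠ R : ℝ in atTop, ∀ k ≤ N,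
    R ^ (k + 17) < (⌊1 / 4 * R⌋₊ : ℝ) ^ (k + 18) := by
  filter_upwards [eventually_gt_atTop ((8 : ℝ) ^ (N + 18))] with R hR k hk
  have h8 : (8 : ℝ) ≤ 8 ^ (N + 18) := by
    calc (8 : ℝ) = 8 ^ 1 := by norm_num
      _ ≤ 8 ^ (N + 18) := pow_le_pow_right₀ (by norm_num) (by omega)
  have hR0 : 0 < R := by linarith
  have hfl : R / 8 ≤ (⌊1 / 4 * R⌋₊ : ℝ) := by
    have := Nat.lt_floor_add_one (1 / 4 * R)
    linarith
  have h1 : (8 : ℝ) ^ (k + 18) < R := lt_of_le_of_lt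
    (pow_le_pow_right₀ (by norm_num) (by omega)) hR
  calc R ^ (k + 17) = R ^ (k + 17) * 8 ^ (k + 18) / 8 ^ (k + 18) := by field_simp
    _ < R ^ (k + 17) * R / 8 ^ (k + 18) := by gcongr
    _ = (R / 8) ^ (k + 18) := by rw [div_pow, ← pow_succ]
    _ ≤ _ := by gcongr

theorem exists_rep {Tc N K : ℕ} (D : Fin 2 → ℕ → ℕ) (hK : 0 < K)
    (hD : ∀ v, K ≤ ∑ j ∈ Finset.range Tc, (N - 23 - D v j)) :
    ∃ rep : ℕ × ℕ → Fin K, ∀ i k, ∃ j, j < Tc ∧ ∃ l, D i j + 21 ≤ l ∧ l < N - 2 ∧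
      rep (j, l) = k := by
  let T : Fin 2 → Finset (Σ _ : ℕ, ℕ) := fun i =>
    (Finset.range Tc).sigma fun j => Finset.Ico (D i j + 21) (N - 2)
  have hT : ∀ i, K ≤ (T i).card := by
    intro i
    rw [Finset.card_sigma]
    refine (hD i).trans (le_of_eq (Finset.sum_congr rfl fun j _ => ?_))
    rw [Nat.card_Ico]; omega
  obtain ⟨r, h0, h1⟩ := exists_map_surjOn_two (T 0) (T 1) hK (hT 0) (hT 1)
  have hr : ∀ i k, ∃ p ∈ T i, r p = k := by
    intro i; fin_cases i
    · exact h0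
    · exact h1
  refine ⟨fun p => r ⟨p.1, p.2⟩, fun i k => ?_⟩
  obtain ⟨⟨j, l⟩, hp, hk⟩ := hr i k
  rw [Finset.mem_sigma, Finset.mem_range, Finset.mem_Ico] at hp
  exact ⟨j, hp.1, l, hp.2.1, hp.2.2, hk⟩

theorem exists_emb {Tc K q : ℕ} (hq : 0 < q) (D a : Fin 2 → ℕ → ℕ) (f : Fin 2 → ℕ)
    (hK : ∑ v, ∑ j ∈ Finset.range Tc, 2 * (D v j - a v j + 18) + ∑ v, f v ≤ 2 * K) :
    Nonempty (((∀ (r : Fin 2) (j : Fin Tc), ZMod (q ^ (D r j - a r j + 18)) ×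
      ZMod (q ^ (D r j - a r j + 18))) × (∀ r : Fin 2, Fin (q ^ f r))) ↪
        (Fin K → Fin q × Fin q)) := by
  have : NeZero q := ⟨hq.ne'⟩
  refine Function.Embedding.nonempty_of_card_le ?_
  have h1 : Fintype.card ((∀ (r : Fin 2) (j : Fin Tc), ZMod (q ^ (D r j - a r j + 18)) ×
      ZMod (q ^ (D r j - a r j + 18))) × (∀ r : Fin 2, Fin (q ^ f r))) =
      q ^ (∑ v, ∑ j ∈ Finset.range Tc, 2 * (D v j - a v j + 18) + ∑ v, f v) := by
    rw [Fintype.card_prod, Fintype.card_pi, Fintype.card_pi, pow_add,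
      ← Finset.prod_pow_eq_pow_sum, ← Finset.prod_pow_eq_pow_sum]
    simp only [Fintype.card_fin]
    congr 1
    refine Finset.prod_congr rfl fun r _ => ?_
    rw [Fintype.card_pi, Finset.sum_range, ← Finset.prod_pow_eq_pow_sum]
    refine Finset.prod_congr rfl fun j _ => ?_
    rw [Fintype.card_prod, ZMod.card]
    ring
  rw [h1, Fintype.card_fun, Fintype.card_prod, Fintype.card_fin, Fintype.card_fin, ← sq,
    ← pow_mul]
  exact Nat.pow_le_pow_right hq hK

/-! ### Achievability -/

/-- The event that makes all slots below `T` good. -/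
def GoodChannels {Ω : Type*} {M : ℕ} (h : Channel Ω M) (est : Feedback Ω M) (sig del : ℕ → ℕ)
    (D a : Fin 2 → ℕ → ℕ) (u b : Vec M) (Tc N T : ℕ) (P : ℝ) (ω : Ω) : Prop :=
  ∀ (t : Fin T) (r : Fin 2), ‖h t r ω‖ ≤ unit N P ∧
    (a r (t % Tc) = 0 ∨
      ‖h t (1 - r) ω - est P t t (1 - r) ω‖ * unit N P ^ (a r (t % Tc) + 20) ≤ unit N P) ∧
    (D r (t % Tc) = 0 ∨ ‖h t (1 - r) ω - est P (sig t) (del t) (1 - r) ω‖ *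
      unit N P ^ (D r (t % Tc) + 20) ≤ unit N P) ∧
    1 ≤ unit N P * ‖dotT (h t r ω) u‖ ∧
    2 ≤ unit N P * ‖beamDet (h t r ω) (h t (1 - r) ω) b u‖ ∧
    2 ≤ unit N P * ‖beamDet (h t r ω) (h t (1 - r) ω) (zeroForce b (h t (1 - r) ω)) u‖

theorem withHighProb_goodChannels {Ω : Type*} [MeasurableSpace Ω] (μ : Measure Ω)
    [IsProbabilityMeasure μ] {M : ℕ} {h : Channel Ω M} {est : Feedback Ω M}
    (hm : ∀ t i, Measurable (h t i)) {α : Fin 2 → ℕ → ℝ} {β : Fin 2 → ℝ} {Tc N : ℕ} (hN : 0 < N)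
    (hcur : ∀ t v, HasQualityExponent (fun P => mse μ h est P t t v) (α v (t % Tc)))
    {sig del : ℕ → ℕ}
    (hdelayed : ∀ t v, HasQualityExponent
      (fun P => ∫ ω, ‖h t v ω - est P (sig t) (del t) v ω‖ ^ 2 ∂μ) (β v))
    {D a : Fin 2 → ℕ → ℕ} (hD : ∀ r j, D r j = 0 ∨ (D r j : ℝ) + 20 ≤ N * β (1 - r))
    (ha : ∀ r j, a r j = 0 ∨ (a r j : ℝ) + 20 ≤ N * α (1 - r) j) {u b : Vec M}
    (hgen : ∀ t i, (∀ᵐ ω ∂μ, dotT (h t i ω) u ≠ 0) ∧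
      (∀ᵐ ω ∂μ, beamDet (h t (1 - i) ω) (h t i ω) b u ≠ 0) ∧
      (∀ᵐ ω ∂μ, beamDet (h t (1 - i) ω) (h t i ω) (zeroForce b (h t i ω)) u ≠ 0)) (T : ℕ) :
    WithHighProb μ (GoodChannels h est sig del D a u b Tc N T) := by
  have hU := tendsto_unit hN
  have hdot : ∀ t i (v : Ω → Vec M), Measurable v → Measurable fun ω => dotT (h t i ω) (v ω) :=
    fun t i v hv => measurable_dotT (hm t i) hv
  have hdet : ∀ t i (v : Ω → Vec M), Measurable v →
      Measurable fun ω => beamDet (h t i ω) (h t (1 - i) ω) (v ω) u := by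
    intro t i v hv
    exact ((hdot t i v hv).mul (hdot t (1 - i) _ measurable_const)).sub
      ((hdot t i _ measurable_const).mul (hdot t (1 - i) v hv))
  refine WithHighProb.forall_fintype fun t => WithHighProb.forall_fintype fun r => ?_
  have hge : ∀ (c : ℝ) (f : Ω → ℂ), Measurable f → (∀ᵐ ω ∂μ, f ω ≠ 0) →
      WithHighProb μ fun P ω => c ≤ unit N P * ‖f ω‖ := by
    intro c f hf h0
    simpa only [WithHighProb, not_le, Function.comp_def] using
      (tendsto_measure_norm_lt_inv μ hf h0 c).comp hU
  have hsw : 1 - (1 - r) = r := sub_sub_cancel 1 r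
  have hg := hgen t (1 - r)
  rw [hsw] at hg
  refine .and ?_ (.and (.or_of_not fun hne => ?_) (.and (.or_of_not fun hne => ?_) (.and ?_
    (.and ?_ ?_))))
  · simpa only [WithHighProb, not_le, Function.comp_def] using
      (tendsto_measure_lt_atTop μ (hm t r).norm).comp hU
  · simpa only [WithHighProb, not_le] using
      tendsto_measure_error hN (f := fun P ω => h t (1 - r) ω - est P t t (1 - r) ω)
        (hcur t (1 - r)) (m := a r (t % Tc) + 20)
        (by push_cast; exact (ha r (t % Tc)).resolve_left hne)
  · simpa only [WithHighProb, not_le] using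
      tendsto_measure_error hN (f := fun P ω => h t (1 - r) ω - est P (sig t) (del t) (1 - r) ω)
        (hdelayed t (1 - r)) (m := D r (t % Tc) + 20)
        (by push_cast; exact (hD r (t % Tc)).resolve_left hne)
  · exact hge 1 _ (hdot t r _ measurable_const) (hgen t r).1
  · exact hge 2 _ (hdet t r _ measurable_const) hg.2.1
  · exact hge 2 _ (hdet t r _ ((measurable_zeroForce b).comp (hm t (1 - r)))) hg.2.2

/-- Symmetric degrees of freedom from current estimates, of exponents `α`, and delayed estimates, of
exponents `β`, where the delayed estimate for slot `t` is that of the channel of slot `sig t`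
available at time `del t`. -/
theorem achievableDoF_of_delayed {Ω : Type*} [MeasurableSpace Ω] (μ : Measure Ω)
    [IsProbabilityMeasure μ] {M Tc : ℕ} (hTc : 0 < Tc) {h : Channel Ω M} {est : Feedback Ω M}
    (hm : ∀ t i, Measurable (h t i))
    (hli : ∀ t, ∀ᵐ ω ∂μ, LinearIndependent ℂ (fun i : Fin 2 => h t i ω))
    {α : Fin 2 → ℕ → ℝ} {β : Fin 2 → ℝ} (h0 : ∀ v j, 0 ≤ α v j) (hαβ : ∀ v j, α v j ≤ β v)
    (hβ1 : ∀ v, β v ≤ 1)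
    (hcur : ∀ t v, HasQualityExponent (fun P => mse μ h est P t t v) (α v (t % Tc)))
    {sig del : ℕ → ℕ} {η : ℕ} (hsig : ∀ t, sig t ≤ t + η) (hdel : ∀ t, del t ≤ t + η)
    (hdelayed : ∀ t v, HasQualityExponent
      (fun P => ∫ ω, ‖h t v ω - est P (sig t) (del t) v ω‖ ^ 2 ∂μ) (β v))
    {d : ℝ} (hα : ∀ v, 3 * d - 2 ≤ (∑ t ∈ Finset.range Tc, α v t) / Tc)
    (hβ : ∀ v, 2 * d - 1 ≤ β v) : AchievableDoF μ h est (fun _ => d) := by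
  intro ε hε
  have hT : (0 : ℝ) < Tc := by exact_mod_cast hTc
  have hα' : ∀ v, (3 * d - 2) * Tc ≤ ∑ t ∈ Finset.range Tc, α v t := fun v =>
    (le_div_iff₀ hT).1 (hα v)
  have hsum0 : ∀ v, 0 ≤ ∑ t ∈ Finset.range Tc, α v t := fun v =>
    Finset.sum_nonneg fun j _ => h0 v j
  have hsum1 : ∀ v, ∑ t ∈ Finset.range Tc, α v t ≤ Tc := fun v => by
    refine (Finset.sum_le_card_nsmul _ _ 1 fun j _ => (hαβ v j).trans (hβ1 v)).trans ?_
    simp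
  have hd1 : d ≤ 1 := by
    have := (hα' 0).trans (hsum1 0)
    have h1 : 3 * d - 2 ≤ 1 := by
      by_contra hcon
      push Not at hcon
      nlinarith
    linarith
  -- A slightly smaller target makes the condition on the mean strict and `d' < 1`; for `d' = 1 / 2`
  -- both conditions hold trivially by nonnegativity of the exponents.
  set d' := max (1 / 2) (d - ε / 2) with hd'
  have hd'1 : d' < 1 := max_lt (by norm_num) (by linarith)
  have hd'2 : 1 / 2 ≤ d' := le_max_left _ _
  have hd'3 : d - ε / 2 ≤ d' := le_max_right _ _
  have hd'α : ∀ v, (3 * d' - 2) * Tc < ∑ t ∈ Finset.range Tc, α v t := by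
    intro v
    rcases max_choice (1 / 2) (d - ε / 2) with hmx | hmx
    · rw [hd', hmx]
      have := hsum0 v
      linarith
    · rw [hd', hmx]
      refine lt_of_lt_of_le ?_ (hα' v)
      nlinarith
  have hd'β : ∀ v, 2 * d' - 1 ≤ β v := by
    intro v
    rcases max_choice (1 / 2) (d - ε / 2) with hmx | hmx
    · rw [hd', hmx]
      linarith [h0 v 0, hαβ v 0]
    · rw [hd', hmx]
      linarith [hβ v]
  -- Layer `r` disturbs user `1 - r`, so its digit counts are governed by the exponents of user `1 -
  -- r`. The bound `187 * 4 / ε` keeps the rounding loss below `ε / 8`.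
  obtain ⟨N, hNalloc, hN20, hNε⟩ := ((exists_digit_allocation hTc
    (α := fun r => α (1 - r)) (β := fun r => β (1 - r)) (fun r => h0 _) (fun r => hαβ _) hd'2 hd'1
    (fun r => hd'α _) (fun r => hd'β _)).and ((eventually_ge_atTop 20).and
      (tendsto_natCast_atTop_atTop.eventually_ge_atTop (187 * 4 / ε)))).exists
  obtain ⟨D, a, f, K, hK, haD, hDβ, haα, hbud, hKD, hrate⟩ := hNalloc
  have hN0 : 0 < N := by omega
  have hNr : (0 : ℝ) < N := by exact_mod_cast hN0
  obtain ⟨u, b, hgen⟩ := exists_generic_beams μ h hm hli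
  obtain ⟨rep, hrep⟩ := exists_rep (Tc := Tc) (N := N) D hK hKD
  have hDN : ∀ r j, D r j + 20 ≤ N := by
    intro r j
    rcases hDβ r j with h1 | h1
    · omega
    · have h2 : (D r j : ℝ) + 20 ≤ N := h1.trans (mul_le_of_le_one_right hNr.le (hβ1 _))
      exact_mod_cast h2
  set m : Fin 2 → ℕ := fun r => ∑ j ∈ Finset.range Tc, 2 * (D r j + (D r j - a r j)) + f r with hmdef
  set lag : ℕ := η + 1 with hlag
  have hη : Tc + η ≤ lag * Tc := by
    rw [hlag, add_mul, one_mul, add_comm]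
    exact Nat.add_le_add_right (Nat.le_mul_of_pos_right _ hTc) _
  obtain ⟨n₁, hn₁⟩ := exists_nat_ge ((1 + 2 * lag) * Tc * 8 / ε)
  refine ⟨max (2 * lag * Tc + 1) n₁, fun n hn => ?_⟩
  have hn1 : 2 * lag * Tc + 1 ≤ n := (le_max_left _ _).trans hn
  have hn2 : ((1 + 2 * lag) * Tc * 8 / ε : ℝ) ≤ n :=
    hn₁.trans (by exact_mod_cast (le_max_right _ _).trans hn)
  have hnr : (0 : ℝ) < n := by
    have : 0 < n := by omega
    exact_mod_cast this
  -- One `lag` serves the final payloads; the other leaves room after the last used slot for the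
  -- delayed estimates, which come up to `η` slots later.
  set L : ℕ := n / Tc - 2 * lag with hL
  have hdivge : 2 * lag ≤ n / Tc := (Nat.le_div_iff_mul_le hTc).2 (by omega)
  have hLlag : (L + 2 * lag) * Tc ≤ n := by
    rw [hL, Nat.sub_add_cancel hdivge]; exact Nat.div_mul_le_self n Tc
  have hLT : (L + lag) * Tc + η ≤ n := by
    refine le_trans ?_ hLlag
    have : (L + 2 * lag) * Tc = (L + lag) * Tc + lag * Tc := by ring
    omega
  set T := (L + lag) * Tc with hTdef
  have hgood := withHighProb_goodChannels μ hm hN0 hcur hdelayed hDβ haα hgen T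
  have hU := tendsto_unit hN0
  set ν := Measure.pi (fun _ : Fin 2 × Fin n => complexGaussian 1) with hν
  let Big : ℝ → Prop := fun P => 0 < P ∧ 100 ≤ unit N P ∧ ‖u‖ ≤ unit N P ∧ ‖b‖ ≤ unit N P ∧
    ∀ k ≤ N, unit N P ^ (k + 17) < (⌊1 / 4 * unit N P⌋₊ : ℝ) ^ (k + 18)
  have hBig : ∀ᶠ P in atTop, Big P :=
    (eventually_gt_atTop 0).and ((hU.eventually_ge_atTop _).and ((hU.eventually_ge_atTop _).and
      ((hU.eventually_ge_atTop _).and (hU.eventually (eventually_pow_lt_floor_pow N)))))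
  have hcode : ∀ P, ∃ C : Code M n, (0 < P → C.PowerConstraint μ est P) ∧
      (Big P → (∀ r, C.size r = ⌊1 / 4 * unit N P⌋₊ ^ (L * m r)) ∧
        C.errorProb μ h est P ≤
          μ {ω | ¬ GoodChannels h est sig del D a u b Tc N T P ω} +
            ν {z | ∃ p, unit N P < ‖z p‖}) := by
    intro P
    by_cases hP : Big P
    · obtain ⟨hP0, hR, hu, hb, hpow⟩ := hP
      have hq : 0 < ⌊1 / 4 * unit N P⌋₊ := Nat.floor_pos.2 (by linarith)
      obtain ⟨emb⟩ := exists_emb (Tc := Tc) (K := K) hq D a f hbud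
      let S : Layout M :=
        { Tc := Tc, N := N, K := K, q := ⌊1 / 4 * unit N P⌋₊, R := unit N P, D := D, a := a
          f := f, u := u, b := b, sig := sig, del := del, rep := rep, emb := emb }
      have hS : S.Valid :=
        { Tc_pos := hTc
          R_ge := hR
          q_le := by
            have := Nat.floor_le (by linarith : 0 ≤ 1 / 4 * unit N P)
            change 4 * (⌊1 / 4 * unit N P⌋₊ : ℝ) ≤ unit N P
            linarith
          pow_lt := hpow
          a_le := haD
          D_le := hDN
          norm_u := hu
          norm_b := hb
          rep_surj := hrep }
      obtain ⟨C, h1, h2, h3⟩ := Layout.exists_code (S := S) (L := L) (lag := lag) (n := n) (η := η)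
        μ hS (Nat.succ_pos η) (by change T ≤ n; omega) hdel hη h est
        (P := P) (unit_pow_two_mul hN0 hP0)
        {ω | GoodChannels h est sig del D a u b Tc N T P ω} (by
          intro ω hω t ht
          have ht' : t < T := ht
          have hg : ∀ r, _ := fun r => hω ⟨t, ht'⟩ r
          have hext : ∀ s t' v, s < n → t' < n →
              extendEst (Code.estimates (n := n) est P ω) s t' v = est P s t' v ω := by
            intro s t' v hs ht'
            simp only [extendEst, dif_pos (And.intro hs ht'), Code.estimates]
          have hs1 := hsig t
          have hs2 := hdel t
          exact
            { norm_le := fun r => (hg r).1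
              current := fun r => by
                rw [hext t t _ (by omega) (by omega)]; exact (hg r).2.1
              delayed := fun r => by
                change D r (t % Tc) = 0 ∨ _
                rw [hext (sig t) (del t) _ (by omega) (by omega)]; exact (hg r).2.2.1
              gain := fun r => (hg r).2.2.2.1
              det := fun r => (hg r).2.2.2.2.1
              det_zf := fun r => (hg r).2.2.2.2.2 })
      exact ⟨C, fun _ => h2, fun _ => ⟨h1, h3⟩⟩
    · by_cases hP0 : 0 < P
      · obtain ⟨C, hC⟩ := exists_silent_code μ M n h est hP0.le
        exact ⟨C, fun _ => hC, fun hb => absurd hb hP⟩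
      · obtain ⟨C, -⟩ := exists_silent_code μ M n h est (le_refl (0 : ℝ))
        exact ⟨C, fun h => absurd h hP0, fun hb => absurd hb hP⟩
  choose C hCpow hC using hcode
  refine ⟨C, hCpow, fun r => ⟨L * m r / (2 * N * n), ?_, ?_⟩, ?_⟩
  · have hx0 : (n : ℝ) - (1 + 2 * lag) * Tc ≤ L * Tc := by
      have h1 : n < (n / Tc + 1) * Tc := by
        rw [mul_comm]; exact Nat.lt_mul_div_succ n hTc
      have h2 : n / Tc = L + 2 * lag := by omega
      rw [h2] at h1
      have h3 : (n : ℝ) < (L + 2 * lag + 1) * Tc := by exact_mod_cast h1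
      linarith
    have hx1 : (L : ℝ) * Tc ≤ n := by
      have : L * Tc ≤ n := le_trans (Nat.mul_le_mul_right _ (by omega)) hLlag
      exact_mod_cast this
    have hm' : 2 * N * Tc * d' - 187 * Tc ≤ (m r : ℝ) := hrate r
    set x : ℝ := L * Tc / n with hx
    have hxle : x ≤ 1 := by rw [hx, div_le_one hnr]; exact hx1
    have hxnn : 0 ≤ x := by positivity
    have hxge : 1 - ε / 8 ≤ x := by
      rw [hx, le_div_iff₀ hnr]
      rw [div_le_iff₀ hε] at hn2
      linarith
    set y : ℝ := m r / (2 * N * Tc) with hy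
    have hyge : d' - ε / 8 ≤ y := by
      rw [hy, le_div_iff₀ (by positivity)]
      rw [div_le_iff₀ hε] at hNε
      nlinarith
    have hxy : (L : ℝ) * m r / (2 * N * n) = x * y := by
      rw [hx, hy]; field_simp
    rw [hxy]
    -- Idle blocks and rounding cost at most `ε / 8` each, on top of the `ε / 2` given up in `d'`.
    have h1 : x * (d' - ε / 8) ≤ x * y := mul_le_mul_of_nonneg_left hyge hxnn
    have h2 : (1 - x) * (d' - ε / 8) ≤ (1 - x) * 1 :=
      mul_le_mul_of_nonneg_left (by linarith) (by linarith)
    linarith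
  · have h1 : Tendsto (fun P => (L * m r / n : ℝ) *
        (Real.log (⌊1 / 4 * unit N P⌋₊ : ℝ) / Real.log P)) atTop
        (𝓝 ((L * m r / n : ℝ) * (1 / (2 * (N : ℝ))))) :=
      (tendsto_log_floor_unit hN0).const_mul _
    have h2 : (L * m r / n : ℝ) * (1 / (2 * (N : ℝ))) = L * m r / (2 * N * n) := by
      field_simp
    rw [h2] at h1
    refine h1.congr' ?_
    filter_upwards [hBig] with P hP
    rw [Code.rate, (hC P hP).1 r]
    simp only [Real.logb]
    push_cast
    rw [Real.log_pow]
    have hlog2 : Real.log 2 ≠ 0 := (Real.log_pos one_lt_two).ne'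
    rw [div_right_comm _ (Real.log 2), div_div_div_cancel_right₀ hlog2]
    push_cast
    ring
  · have hz : Tendsto (fun P => ν {z | ∃ p, unit N P < ‖z p‖}) atTop (𝓝 0) := by
      have h1 : WithHighProb ν fun P z => ∀ p, ‖z p‖ ≤ unit N P := by
        refine WithHighProb.forall_fintype fun p => ?_
        simpa only [WithHighProb, not_le, Function.comp_def] using
          (tendsto_measure_lt_atTop ν (measurable_pi_apply p).norm).comp hU
      simpa only [WithHighProb, not_forall, not_le] using h1
    have hsum := Tendsto.add hgood hz
    rw [add_zero] at hsum
    refine tendsto_of_tendsto_of_tendsto_of_le_of_le' tendsto_const_nhds hsum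
      (Eventually.of_forall fun _ => zero_le) ?_
    filter_upwards [hBig] with P hP
    exact (hC P hP).2

end MisoBC
end

/-! ### The two feedback regimes. -/

theorem corollary7 {Ω : Type*} [MeasurableSpace Ω] (μ : MeasureTheory.Measure Ω)
    [MeasureTheory.IsProbabilityMeasure μ] (M Tc : ℕ) (hM : 2 ≤ M) (hTc : 0 < Tc)
    (h : MisoBC.Channel Ω M) (est : MisoBC.Feedback Ω M) (α : Fin 2 → ℕ → ℝ)
    (hset : MisoBC.PeriodicallyEvolving μ Tc h est α) (d : ℝ) (hd : 0 ≤ d)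
    (hα : ∀ i, 3 * d - 2 ≤ (∑ t ∈ Finset.range Tc, α i t) / Tc) :
    (∀ β : Fin 2 → ℝ, (∀ i, MisoBC.HasDelayedExponent μ h est i (β i)) →
      (∀ i, α i (Tc - 1) ≤ β i) → (∀ i, β i ≤ 1) → (∀ i, 2 * d - 1 ≤ β i) →
      MisoBC.AchievableDoF μ h est (fun _ => d)) ∧
    ((∀ i, 2 * d - 1 ≤ α i (Tc - 1)) →
      MisoBC.AchievableDoF μ h (MisoBC.stopAfterCoherence Tc est) (fun _ => d)) := by
  have hper : ∀ i t, α i (t % Tc) = α i t := fun i t =>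
    Function.Periodic.map_mod_nat (f := α i) (hset.periodic i) t
  have hlast : ∀ i t, α i t ≤ α i (Tc - 1) := fun i t => by
    rw [← hper i t]
    have := Nat.mod_lt t hTc
    exact hset.exponent_mono i _ _ (by omega) (by omega)
  refine ⟨fun β hβ hαβ hβ1 hdβ => ?_, fun hdα => ?_⟩
  · choose η₀ hη₀ using hβ
    refine MisoBC.achievableDoF_of_delayed μ hTc hset.measurable_channel hset.linearIndependent
      (β := β) hset.exponent_nonneg (fun i t => (hlast i t).trans (hαβ i)) hβ1
      (fun t i => by rw [hper]; exact hset.current_exponent t i)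
      -- A delay of `η₀ 0 + η₀ 1` is large enough for both users.
      (sig := fun t => t) (del := fun t => t + (η₀ 0 + η₀ 1)) (η := η₀ 0 + η₀ 1)
      (fun t => Nat.le_add_right _ _) (fun t => le_rfl) (fun t i => ?_) hα hdβ
    refine hη₀ i _ ?_ t
    fin_cases i
    · exact Nat.le_add_right _ _
    · exact Nat.le_add_left _ _
  · have hdiv : ∀ t, t / Tc * Tc + t % Tc = t := fun t => Nat.div_add_mod' t Tc
    have hend : ∀ t, t ≤ t / Tc * Tc + (Tc - 1) := fun t => by
      have := hdiv t
      have := Nat.mod_lt t hTc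
      omega
    have hdivend : ∀ t, (t / Tc * Tc + (Tc - 1)) / Tc = t / Tc := fun t => by
      rw [mul_comm, Nat.mul_add_div hTc, Nat.div_eq_of_lt (by omega : Tc - 1 < Tc), add_zero]
    have hcur : ∀ t i P, MisoBC.stopAfterCoherence Tc est P t t i = est P t t i := by
      intro t i P
      simp only [MisoBC.stopAfterCoherence, min_eq_left (hend t)]
    refine MisoBC.achievableDoF_of_delayed μ hTc hset.measurable_channel hset.linearIndependent
      (β := fun i => α i (Tc - 1)) hset.exponent_nonneg hlast
      (fun i => hset.exponent_le_one i _)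
      (fun t i => by
        rw [hper]
        simpa only [MisoBC.mse, hcur] using hset.current_exponent t i)
      -- For the slot-`t` channel, the estimate used is the current one of the last slot of its
      -- coherence period. That slot has the same channel almost surely, its current exponent is `α
      -- i (Tc - 1)`, and the estimate is untouched by stopping the feedback.
      (sig := fun t => t / Tc * Tc + (Tc - 1)) (del := fun t => t / Tc * Tc + (Tc - 1)) (η := Tc)
      (fun t => by have := hdiv t; omega) (fun t => by have := hdiv t; omega)
      (fun t i => ?_) hα hdα
    have hexp := hset.current_exponent (t / Tc * Tc + (Tc - 1)) i
    have hαe : α i (t / Tc * Tc + (Tc - 1)) = α i (Tc - 1) := by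
      rw [← hper, Nat.mul_add_mod_self_right, Nat.mod_eq_of_lt (by omega)]
    rw [hαe] at hexp
    convert hexp using 2 with P
    rw [MisoBC.mse]
    refine MeasureTheory.integral_congr_ae ?_
    filter_upwards [hset.block_fading t (t / Tc * Tc + (Tc - 1)) i (hdivend t).symm] with ω hω
    simp only [hcur, hω]
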